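/- **Setup.** Let $\Gamma$ be a graph (possibly infinite) without loops and multiple edges, with vertex set $I$. Put $i\cdot i=2$, $i\cdot j=-1$ if $i,j$ are joined by an edge, and $i\cdot j=0$ otherwise. Let $\nu=\sum_i\nu_i\, i\in\mathbb N[I]$, $m=|\nu|=\sum_i\nu_i$, and let $\mathrm{Seq}(\nu)$ be the set of sequences $\mathbf i=i_1\dots i_m$ of vertices in which each vertex $i$ appears $\nu_i$ times. The group $S_m$ acts on $\mathrm{Seq}(\nu)$: the entry of $\mathbf i$ in position $a$ is the entry of $w(\mathbf i)$ in position $w(a)$. Let $s_k=(k,k+1)$. The ring $R(\nu)$ is generated by $1_{\mathbf i}$, dots $x_{k,\mathbf i}$ ($1\le k\le m$) and crossings $\delta_{k,\mathbf i}$ ($1\le k<m$), $\mathbf i\in\mathrm{Seq}(\nu)$. The $1_{\mathbf i}$ are orthogonal idempotents with sum $1$, $x_{k,\mathbf i}\in 1_{\mathbf i}R(\nu)1_{\mathbf i}$, $\delta_{k,\mathbf i}\in 1_{s_k(\mathbf i)}R(\nu)1_{\mathbf i}$, and the relations are as follows (each applied to $1_{\mathbf i}$; we omit the sequence, which is determined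 by composability, so that $\delta_k\delta_l$ means $\delta_{k,s_l(\mathbf i)}\delta_{l,\mathbf i}$ and so on): - $x_kx_l=x_lx_k$; $\ \delta_kx_l=x_l\delta_k$ for $l\ne k,k+1$; $\ \delta_k\delta_l=\delta_l\delta_k$ for $|k-l|>1$; - $\delta_k^2=0$ if $i_k=i_{k+1}$; $\ \delta_k^2=1$ if $i_k\cdot i_{k+1}=0$; $\ \delta_k^2=x_k+x_{k+1}$ if $i_k\cdot i_{k+1}=-1$; - $x_k\delta_k=\delta_kx_{k+1}$ and $x_{k+1}\delta_k=\delta_kx_k$ if $i_k\ne i_{k+1}$; $\ x_k\delta_k-\delta_kx_{k+1}=1=\delta_kx_k-x_{k+1}\delta_k$ if $i_k=i_{k+1}$; - $\delta_k\delta_{k+1}\delta_k-\delta_{k+1}\delta_k\delta_{k+1}$ equals $1$ if $i_k=i_{k+2}$ and $i_k\cdot i_{k+1}=-1$, and equals $0$ otherwise. A diagram from $\mathbf i$ to $\mathbf j$ is a composable product of generators with rightmost (bottom) sequence $\mathbf i$ and leftmost (top) sequence $\mathbf j$. Its degree is the sum of the degrees $\deg 1_{\mathbf i}=0$, $\deg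 x_{k,\mathbf i}=2$, $\deg\delta_{k,\mathbf i}=-i_k\cdot i_{k+1}$. The degree $d$ part of $R(\nu)$ is the span of the diagrams of degree $d$, and the degree $d$ part of $1_{\mathbf j}R(\nu)1_{\mathbf i}$ is its intersection with $1_{\mathbf j}R(\nu)1_{\mathbf i}$. For each $w\in S_m$ fix a minimal presentation (reduced word) $w=s_{k_1}\cdots s_{k_r}$, and let $\hat w_{\mathbf i}=\delta_{k_1}\cdots\delta_{k_r}1_{\mathbf i}$ be the corresponding diagram with bottom sequence $\mathbf i$. Let ${}_{\mathbf j}S_{\mathbf i}=\{w\in S_m: w(\mathbf i)=\mathbf j\}$. **Theorem 2.5.** For any choice of minimal presentations the following hold. 1. For all $\mathbf i,\mathbf j\in\mathrm{Seq}(\nu)$, the abelian group $1_{\mathbf j}R(\nu)1_{\mathbf i}$ is the direct sum of its degree $d$ parts, $d\in\mathbb Z$, and it is free with a basis consisting of the elements $$\hat w_{\mathbf i}\,x_{1,\mathbf i}^{u_1}\cdots x_{m,\mathbf i}^{u_m},\qquad w\in{}_{\mathbf j}S_{\mathbf i},\quad (u_1,\dots,u_m)\in\mathbb N^m$$ (distinct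 pairs $(w,u)$ giving distinct elements). Each of them is homogeneous, of degree the degree of the diagram $\hat w_{\mathbf i}$ plus $2\sum_k u_k$. 2. Choose any orientation of the edges of $\Gamma$, and let $\mathcal Pol_\nu=\bigoplus_{\mathbf i\in\mathrm{Seq}(\nu)}\mathcal Pol_{\mathbf i}$ with $\mathcal Pol_{\mathbf i}=\mathbb Z[x_1,\dots,x_m]$. There is a unique action of $R(\nu)$ on $\mathcal Pol_\nu$ such that $1_{\mathbf i}$ is the projection to $\mathcal Pol_{\mathbf i}$, $x_{k,\mathbf i}$ acts on $\mathcal Pol_{\mathbf i}$ by multiplication by $x_k$, and $\delta_{k,\mathbf i}$ maps $f\in\mathcal Pol_{\mathbf i}$ to the following element of $\mathcal Pol_{s_k(\mathbf i)}$: to $\frac{f-s_kf}{x_k-x_{k+1}}$ if $i_k=i_{k+1}$; to $s_kf$ if $i_k\cdot i_{k+1}=0$ or the edge is oriented $i_k\leftarrow i_{k+1}$; to $(x_k+x_{k+1})\,s_kf$ if it is oriented $i_k\to i_{k+1}$. (Here $s_kf$ is $f$ with $x_k$ and $x_{k+1}$ exchanged.) This representation is faithful. -/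

import Mathlib

namespace KL

universe u

variable {I : Type u}

/-- The length `m = |ν|` of an element `ν = ∑ ν_i · i` of `ℕ[I]`. -/
def len (ν : I →₀ ℕ) : ℕ := ν.sum fun _ n => n

/-- The (0-based) position of the left one of the two strands meeting in the `k`-th crossing. -/
def lpos {m : ℕ} (k : Fin (m - 1)) : Fin m := ⟨k.1, by have := k.2; omega⟩

/-- The (0-based) position of the right one of the two strands meeting in the `k`-th crossing. -/
def rpos {m : ℕ} (k : Fin (m - 1)) : Fin m := ⟨k.1 + 1, by have := k.2; omega⟩

/-- The simple transposition `s_k = (k, k+1)` of the symmetric group on `m` letters. -/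
def simpleTr {m : ℕ} (k : Fin (m - 1)) : Equiv.Perm (Fin m) := Equiv.swap (lpos k) (rpos k)

/-- The product `s_{k₁} ⋯ s_{k_r}` of a word in the simple transpositions. -/
def wordProd {m : ℕ} (l : List (Fin (m - 1))) : Equiv.Perm (Fin m) := (l.map simpleTr).prod

/-- The word `l` is a minimal presentation (reduced word) of the permutation `w`. -/
def IsMinimalPresentation {m : ℕ} (l : List (Fin (m - 1))) (w : Equiv.Perm (Fin m)) : Prop :=
  wordProd l = w ∧ ∀ l' : List (Fin (m - 1)), wordProd l' = w → l.length ≤ l'.length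

/-- `Seq(ν)`: the sequences of vertices of length `|ν|` in which every vertex `v` appears
`ν_v` times. -/
@[ext] structure Seq (ν : I →₀ ℕ) where
  vertex : Fin (len ν) → I
  card_eq : ∀ v : I, Nat.card {a // vertex a = v} = ν v

instance Seq.instFinite (ν : I →₀ ℕ) : Finite (Seq ν) := by
  have hmem : ∀ (i : Seq ν) (a : Fin (len ν)), i.vertex a ∈ ν.support := by
    intro i a
    rw [Finsupp.mem_support_iff, ← i.card_eq]
    have : Nonempty {b // i.vertex b = i.vertex a} := ⟨⟨a, rfl⟩⟩
    exact Nat.card_pos.ne'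
  refine Finite.of_injective
    (fun (i : Seq ν) (a : Fin (len ν)) => (⟨i.vertex a, hmem i a⟩ : ν.support)) ?_
  intro i j h
  ext a
  exact congrArg Subtype.val (congrFun h a)

noncomputable instance Seq.instFintype (ν : I →₀ ℕ) : Fintype (Seq ν) := Fintype.ofFinite _

/-- The action of permutations on sequences: the entry of `i` in position `a` is the entry of
`w(i)` in position `w(a)`. -/
def Seq.perm {ν : I →₀ ℕ} (w : Equiv.Perm (Fin (len ν))) (i : Seq ν) : Seq ν where
  vertex a := i.vertex (w.symm a)
  card_eq v := by
    rw [← i.card_eq v]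
    exact Nat.card_congr (w.symm.subtypeEquiv fun _ => Iff.rfl)

/-- `s_k(i)`: the entries in positions `k` and `k+1` are switched. -/
def Seq.swap {ν : I →₀ ℕ} (k : Fin (len ν - 1)) (i : Seq ν) : Seq ν := i.perm (simpleTr k)

/-- The set `_jS_i` of the permutations that take `i` to `j`. -/
def permSet {ν : I →₀ ℕ} (j i : Seq ν) : Set (Equiv.Perm (Fin (len ν))) := {w | i.perm w = j}

open Classical in
/-- The Cartan form `i · j` on vertices. -/
noncomputable def cartan (Γ : SimpleGraph I) (i j : I) : ℤ :=
  if i = j then 2 else if Γ.Adj i j then -1 else 0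

/-- The elementary diagrams: the vertical strands `1_i`, a single dot on the `k`-th strand
`x_{k,i}`, and a single crossing `δ_{k,i}` of the strands in positions `k`, `k+1`. The sequence
`i` is the sequence of labels at the bottom. -/
inductive Gen (ν : I →₀ ℕ) : Type u
  | idem (i : Seq ν) : Gen ν
  | dot (k : Fin (len ν)) (i : Seq ν) : Gen ν
  | cross (k : Fin (len ν - 1)) (i : Seq ν) : Gen ν

section Free

variable {ν : I →₀ ℕ}

/-- `1_i` in the free ring on the elementary diagrams. -/
def fe (i : Seq ν) : FreeAlgebra ℤ (Gen ν) := FreeAlgebra.ι ℤ (Gen.idem i)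

/-- `x_{k,i}` in the free ring on the elementary diagrams. -/
def fx (k : Fin (len ν)) (i : Seq ν) : FreeAlgebra ℤ (Gen ν) := FreeAlgebra.ι ℤ (Gen.dot k i)

/-- `δ_{k,i}` in the free ring on the elementary diagrams. -/
def fd (k : Fin (len ν - 1)) (i : Seq ν) : FreeAlgebra ℤ (Gen ν) :=
  FreeAlgebra.ι ℤ (Gen.cross k i)

end Free

/-- The defining relations of `R(ν)`. A product `a * b` is the diagram of `a` put on top of the
diagram of `b`. -/
inductive Rel (Γ : SimpleGraph I) (ν : I →₀ ℕ) :
    FreeAlgebra ℤ (Gen ν) → FreeAlgebra ℤ (Gen ν) → Prop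
  -- Diagrams can be stacked only if the labels match, and are zero otherwise.
  | idem_mul_self (i : Seq ν) : Rel Γ ν (fe i * fe i) (fe i)
  | idem_mul_ne (i j : Seq ν) (h : i ≠ j) : Rel Γ ν (fe i * fe j) 0
  | sum_idem : Rel Γ ν (∑ i : Seq ν, fe i) 1
  | dot_bot (k : Fin (len ν)) (i : Seq ν) : Rel Γ ν (fx k i * fe i) (fx k i)
  | dot_top (k : Fin (len ν)) (i : Seq ν) : Rel Γ ν (fe i * fx k i) (fx k i)
  | cross_bot (k : Fin (len ν - 1)) (i : Seq ν) : Rel Γ ν (fd k i * fe i) (fd k i)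
  | cross_top (k : Fin (len ν - 1)) (i : Seq ν) : Rel Γ ν (fe (i.swap k) * fd k i) (fd k i)
  -- Isotopy: dots and crossings on disjoint sets of strands can be moved past each other.
  | dot_dot (k l : Fin (len ν)) (i : Seq ν) : Rel Γ ν (fx k i * fx l i) (fx l i * fx k i)
  | cross_dot (k : Fin (len ν - 1)) (l : Fin (len ν)) (i : Seq ν)
      (hl : l ≠ lpos k) (hr : l ≠ rpos k) :
      Rel Γ ν (fd k i * fx l i) (fx l (i.swap k) * fd k i)
  | cross_cross (k l : Fin (len ν - 1)) (i : Seq ν) (h : k.1 + 1 < l.1) :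
      Rel Γ ν (fd k (i.swap l) * fd l i) (fd l (i.swap k) * fd k i)
  -- Two strands crossing twice.
  | double_eq (k : Fin (len ν - 1)) (i : Seq ν) (h : i.vertex (lpos k) = i.vertex (rpos k)) :
      Rel Γ ν (fd k (i.swap k) * fd k i) 0
  | double_far (k : Fin (len ν - 1)) (i : Seq ν) (hne : i.vertex (lpos k) ≠ i.vertex (rpos k))
      (h : ¬ Γ.Adj (i.vertex (lpos k)) (i.vertex (rpos k))) :
      Rel Γ ν (fd k (i.swap k) * fd k i) (fe i)
  | double_adj (k : Fin (len ν - 1)) (i : Seq ν)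
      (h : Γ.Adj (i.vertex (lpos k)) (i.vertex (rpos k))) :
      Rel Γ ν (fd k (i.swap k) * fd k i) (fx (lpos k) i + fx (rpos k) i)
  -- Sliding a dot through a crossing of strands with different labels.
  | slide_ne_left (k : Fin (len ν - 1)) (i : Seq ν)
      (h : i.vertex (lpos k) ≠ i.vertex (rpos k)) :
      Rel Γ ν (fx (lpos k) (i.swap k) * fd k i) (fd k i * fx (rpos k) i)
  | slide_ne_right (k : Fin (len ν - 1)) (i : Seq ν)
      (h : i.vertex (lpos k) ≠ i.vertex (rpos k)) :
      Rel Γ ν (fx (rpos k) (i.swap k) * fd k i) (fd k i * fx (lpos k) i)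
  -- Sliding a dot through a crossing of strands with equal labels.
  | slide_eq_left (k : Fin (len ν - 1)) (i : Seq ν)
      (h : i.vertex (lpos k) = i.vertex (rpos k)) :
      Rel Γ ν (fx (lpos k) (i.swap k) * fd k i - fd k i * fx (rpos k) i) (fe i)
  | slide_eq_right (k : Fin (len ν - 1)) (i : Seq ν)
      (h : i.vertex (lpos k) = i.vertex (rpos k)) :
      Rel Γ ν (fd k i * fx (lpos k) i - fx (rpos k) (i.swap k) * fd k i) (fe i)
  -- Triple crossings, of the strands in positions `k`, `k+1`, `k+2`, where `l = k+1`.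
  | braid_easy (k l : Fin (len ν - 1)) (hkl : l.1 = k.1 + 1) (i : Seq ν)
      (h : ¬ (i.vertex (lpos k) = i.vertex (rpos l) ∧
        Γ.Adj (i.vertex (lpos k)) (i.vertex (rpos k)))) :
      Rel Γ ν (fd k ((i.swap k).swap l) * fd l (i.swap k) * fd k i)
        (fd l ((i.swap l).swap k) * fd k (i.swap l) * fd l i)
  | braid_hard (k l : Fin (len ν - 1)) (hkl : l.1 = k.1 + 1) (i : Seq ν)
      (h : i.vertex (lpos k) = i.vertex (rpos l))
      (hadj : Γ.Adj (i.vertex (lpos k)) (i.vertex (rpos k))) :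
      Rel Γ ν (fd k ((i.swap k).swap l) * fd l (i.swap k) * fd k i
        - fd l ((i.swap l).swap k) * fd k (i.swap l) * fd l i) (fe i)

/-- The ring `R(ν)` of the graph `Γ`. -/
def R (Γ : SimpleGraph I) (ν : I →₀ ℕ) : Type u := RingQuot (Rel Γ ν)

noncomputable instance R.instRing (Γ : SimpleGraph I) (ν : I →₀ ℕ) : Ring (R Γ ν) :=
  inferInstanceAs (Ring (RingQuot (Rel Γ ν)))

section Ring

variable (Γ : SimpleGraph I) {ν : I →₀ ℕ}

/-- The quotient map from the free ring to `R(ν)`. -/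
noncomputable def mk (ν : I →₀ ℕ) : FreeAlgebra ℤ (Gen ν) →+* R Γ ν := RingQuot.mkRingHom (Rel Γ ν)

/-- The idempotent `1_i` of `R(ν)`. -/
noncomputable def e (i : Seq ν) : R Γ ν := mk Γ ν (fe i)

/-- The dot `x_{k,i}` of `R(ν)`. -/
noncomputable def x (k : Fin (len ν)) (i : Seq ν) : R Γ ν := mk Γ ν (fx k i)

/-- The crossing `δ_{k,i}` of `R(ν)`. -/
noncomputable def δ (k : Fin (len ν - 1)) (i : Seq ν) : R Γ ν := mk Γ ν (fd k i)

/-- The summand `_jR(ν)_i = 1_j R(ν) 1_i`, as a subgroup of `R(ν)`. -/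
noncomputable def homPart (j i : Seq ν) : Submodule ℤ (R Γ ν) where
  carrier := {r | ∃ s : R Γ ν, r = e Γ j * s * e Γ i}
  add_mem' := by
    rintro _ _ ⟨s, rfl⟩ ⟨t, rfl⟩
    exact ⟨s + t, by rw [mul_add, add_mul]⟩
  zero_mem' := ⟨0, by rw [mul_zero, zero_mul]⟩
  smul_mem' := by
    rintro c _ ⟨s, rfl⟩
    exact ⟨c • s, by rw [mul_smul_comm, smul_mul_assoc]⟩

end Ring

/-- `Diagram i j` is the type of diagrams with bottom `i` and top `j`, built from the bottom to
the top by adding one dot or one crossing at a time. -/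
inductive Diagram {ν : I →₀ ℕ} (i : Seq ν) : Seq ν → Type u
  | id : Diagram i i
  | dot (k : Fin (len ν)) {j : Seq ν} (D : Diagram i j) : Diagram i j
  | cross (k : Fin (len ν - 1)) {j : Seq ν} (D : Diagram i j) : Diagram i (j.swap k)

section Diagrams

variable (Γ : SimpleGraph I) {ν : I →₀ ℕ}

/-- The element of `R(ν)` represented by a diagram. -/
noncomputable def Diagram.eval {i : Seq ν} : {j : Seq ν} → Diagram i j → R Γ ν
  | _, .id => e Γ i
  | _, .dot k (j := j) D => x Γ k j * D.eval
  | _, .cross k (j := j) D => δ Γ k j * D.eval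

/-- The degree of a diagram: a dot has degree `2`, a crossing of strands labelled `a`, `b` has
degree `- a · b`. -/
noncomputable def Diagram.degree {i : Seq ν} : {j : Seq ν} → Diagram i j → ℤ
  | _, .id => 0
  | _, .dot _ D => 2 + D.degree
  | _, .cross k (j := j) D => -cartan Γ (j.vertex (lpos k)) (j.vertex (rpos k)) + D.degree

/-- The degree `d` part of `R(ν)`, spanned by the diagrams of degree `d`. -/
noncomputable def degPart (ν : I →₀ ℕ) (d : ℤ) : Submodule ℤ (R Γ ν) :=
  Submodule.span ℤ {r | ∃ (i j : Seq ν) (D : Diagram i j), D.degree Γ = d ∧ r = D.eval Γ}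

/-- The degree `d` part of `_jR(ν)_i`. -/
noncomputable def homDegPart (j i : Seq ν) (d : ℤ) : Submodule ℤ (homPart Γ j i) :=
  (degPart Γ ν d).comap (homPart Γ j i).subtype

/-- The sequence obtained from `i` by applying `s_{k_r}`, …, `s_{k₁}` in this order. -/
def Seq.act (i : Seq ν) : List (Fin (len ν - 1)) → Seq ν
  | [] => i
  | k :: l => (i.act l).swap k

/-- The diagram with bottom `i` and no dots given by a word `s_{k₁} ⋯ s_{k_r}`, the last letter
of the word being the lowest crossing. -/
def wordDiagram (i : Seq ν) : (l : List (Fin (len ν - 1))) → Diagram i (i.act l)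
  | [] => .id
  | k :: l => .cross k (wordDiagram i l)

/-- The element `ŵ_i` obtained from a presentation `l` of the permutation `w`. -/
noncomputable def hat (l : List (Fin (len ν - 1))) (i : Seq ν) : R Γ ν := (wordDiagram i l).eval Γ

/-- The dot monomial `x_{1,i}^{u_1} ⋯ x_{m,i}^{u_m}` (the factors commute). -/
noncomputable def dotMonomial (i : Seq ν) (u : Fin (len ν) → ℕ) : R Γ ν :=
  (List.ofFn fun k => x Γ k i ^ u k).prod

end Diagrams

/-- A choice of an orientation of each edge of `Γ`; `arrow i j` means that `i` and `j` are joined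
by an edge which is oriented from `i` to `j`. -/
structure Orientation (Γ : SimpleGraph I) where
  arrow : I → I → Prop
  adj_iff : ∀ i j, Γ.Adj i j ↔ arrow i j ∨ arrow j i
  asymm : ∀ i j, arrow i j → ¬ arrow j i

/-- The group `Pol_ν`, the direct sum over `i ∈ Seq(ν)` of the groups `Pol_i = ℤ[x_1, …, x_m]`.
The element `f ∈ Pol_i` is `Finsupp.single i f`. -/
abbrev Pol (ν : I →₀ ℕ) : Type u := Seq ν →₀ MvPolynomial (Fin (len ν)) ℤ

/-- The map `f ↦ s_k f` from `Pol_i` to `Pol_{s_k(i)}`, on the underlying polynomials. -/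
noncomputable def sPol {m : ℕ} (k : Fin (m - 1)) (f : MvPolynomial (Fin m) ℤ) :
    MvPolynomial (Fin m) ℤ :=
  MvPolynomial.rename (simpleTr k) f

open MvPolynomial in
/-- The ring homomorphism `ρ` is the action of `R(ν)` on `Pol_ν` attached to an orientation of
`Γ`: the generators act by the following rules. (An element of `_jR(ν)_i` then acts by zero on
`Pol_k`, `k ≠ i`, and maps `Pol_i` to `Pol_j`.) -/
structure IsPolAction {Γ : SimpleGraph I} (o : Orientation Γ) {ν : I →₀ ℕ}
    (ρ : R Γ ν →+* Module.End ℤ (Pol ν)) : Prop where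
  idem_self : ∀ (i : Seq ν) (f : MvPolynomial (Fin (len ν)) ℤ),
    ρ (e Γ i) (Finsupp.single i f) = Finsupp.single i f
  idem_ne : ∀ (i j : Seq ν) (f : MvPolynomial (Fin (len ν)) ℤ), j ≠ i →
    ρ (e Γ i) (Finsupp.single j f) = 0
  dot : ∀ (k : Fin (len ν)) (i : Seq ν) (f : MvPolynomial (Fin (len ν)) ℤ),
    ρ (x Γ k i) (Finsupp.single i f) = Finsupp.single i (X k * f)
  cross_far : ∀ (k : Fin (len ν - 1)) (i : Seq ν) (f : MvPolynomial (Fin (len ν)) ℤ),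
    i.vertex (lpos k) ≠ i.vertex (rpos k) →
    ¬ Γ.Adj (i.vertex (lpos k)) (i.vertex (rpos k)) →
    ρ (δ Γ k i) (Finsupp.single i f) = Finsupp.single (i.swap k) (sPol k f)
  /-- For equal labels the crossing acts by the divided difference
  `g = (f - s_k f) / (x_k - x_{k+1})`. -/
  cross_eq : ∀ (k : Fin (len ν - 1)) (i : Seq ν) (f : MvPolynomial (Fin (len ν)) ℤ),
    i.vertex (lpos k) = i.vertex (rpos k) →
    ∃ g : MvPolynomial (Fin (len ν)) ℤ, (X (lpos k) - X (rpos k)) * g = f - sPol k f ∧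
      ρ (δ Γ k i) (Finsupp.single i f) = Finsupp.single (i.swap k) g
  cross_left : ∀ (k : Fin (len ν - 1)) (i : Seq ν) (f : MvPolynomial (Fin (len ν)) ℤ),
    o.arrow (i.vertex (rpos k)) (i.vertex (lpos k)) →
    ρ (δ Γ k i) (Finsupp.single i f) = Finsupp.single (i.swap k) (sPol k f)
  cross_right : ∀ (k : Fin (len ν - 1)) (i : Seq ν) (f : MvPolynomial (Fin (len ν)) ℤ),
    o.arrow (i.vertex (lpos k)) (i.vertex (rpos k)) →
    ρ (δ Γ k i) (Finsupp.single i f) =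
      Finsupp.single (i.swap k) ((X (lpos k) + X (rpos k)) * sPol k f)

end KL

/-! The ring is held between a spanning set and a representation in which that set stays
independent.

Spanning. Filter `R(ν) 1_i` by the number of crossings, with all dots at the bottom. Modulo diagrams
with fewer crossings, dots slide freely through crossings and the braid relations hold exactly,
while a double crossing is itself expressed by fewer crossings. By Matsumoto's theorem for the
symmetric group (`braidEquiv_or_hasSquare`) every word can be changed by braid moves either into the
chosen reduced word of its permutation or into a word with a repeated adjacent letter. Induction on
the number of crossings shows that the elements `ŵ_i x^u` span (`lowSpan_le_span`).

Independence. The operators on polynomials satisfy the defining relations (`lift_genOp_rel`). This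
is checked in the field of rational functions, where every crossing acts as `f ↦ A · s_k f + B · f`
with `A ≠ 0`. Hence `ŵ` acts as a nonzero multiple of the permutation `w` of the variables plus a
combination of permutations given by shorter words (`exists_wordOp_sub_mem`). Distinct permutations
are linearly independent over the field by Dedekind's lemma (`linearIndependent_permFun`), so no
nontrivial combination of the `ŵ_i x^u` acts by zero (`eq_zero_of_sum_wordOp`). This one fact yields
both the basis and the faithfulness.

Grading. The relations are homogeneous, so sending a diagram `D` to `D t^(deg D)` defines a ring
homomorphism from `R(ν)` to Laurent polynomials over `R(ν)` (`coaction`). Its coefficients separate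
the degree parts, and the homogeneous basis shows that these parts exhaust `1_j R(ν) 1_i`. -/

namespace KL

/-! ### Braid moves and normal forms of words of numbers -/

/-- The congruence on words generated by the braid relations, where `v a` is the number of the
simple transposition denoted by the letter `a`. -/
inductive BraidEquiv {α : Type*} (v : α → ℕ) : List α → List α → Prop
  | refl (l) : BraidEquiv v l l
  | symm {l l'} : BraidEquiv v l l' → BraidEquiv v l' l
  | trans {l l' l''} : BraidEquiv v l l' → BraidEquiv v l' l'' → BraidEquiv v l l''
  | cons (a) {l l'} : BraidEquiv v l l' → BraidEquiv v (a :: l) (a :: l')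
  | far (a b l) : v a + 1 < v b → BraidEquiv v (a :: b :: l) (b :: a :: l)
  | braid (a b l) : v b = v a + 1 → BraidEquiv v (a :: b :: a :: l) (b :: a :: b :: l)

namespace BraidEquiv

variable {α : Type*} {v : α → ℕ}

theorem append_left (t : List α) {l l' : List α} (h : BraidEquiv v l l') :
    BraidEquiv v (t ++ l) (t ++ l') := by
  induction t with
  | nil => exact h
  | cons a t ih => exact ih.cons a

theorem length_eq {l l' : List α} (h : BraidEquiv v l l') : l.length = l'.length := by
  induction h with
  | refl => rfl
  | symm _ ih => exact ih.symm
  | trans _ _ ih ih' => exact ih.trans ih'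
  | cons _ _ ih => simp [ih]
  | far => rfl
  | braid => rfl

/-- A word over `Fin N` can be replaced along an equivalence of the underlying words of numbers. -/
theorem lift {N : ℕ} {l l' : List ℕ} (h : BraidEquiv id l l') :
    (∀ L : List (Fin N), L.map Fin.val = l →
      ∃ L' : List (Fin N), L'.map Fin.val = l' ∧ BraidEquiv Fin.val L L') ∧
    (∀ L : List (Fin N), L.map Fin.val = l' →
      ∃ L' : List (Fin N), L'.map Fin.val = l ∧ BraidEquiv Fin.val L L') := by
  induction h with
  | refl l => exact ⟨fun L h => ⟨L, h, .refl _⟩, fun L h => ⟨L, h, .refl _⟩⟩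
  -- Symmetry exchanges the two lifting directions, which is why both are carried through the
  -- induction.
  | symm _ ih => exact ⟨ih.2, ih.1⟩
  | trans _ _ ih ih' =>
    refine ⟨fun L h => ?_, fun L h => ?_⟩
    · obtain ⟨M, hM, h1⟩ := ih.1 L h
      obtain ⟨M', hM', h2⟩ := ih'.1 M hM
      exact ⟨M', hM', h1.trans h2⟩
    · obtain ⟨M, hM, h1⟩ := ih'.2 L h
      obtain ⟨M', hM', h2⟩ := ih.2 M hM
      exact ⟨M', hM', h1.trans h2⟩
  | cons a _ ih =>
    refine ⟨fun L h => ?_, fun L h => ?_⟩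
    · obtain ⟨b, M, rfl, rfl, hM⟩ := List.map_eq_cons_iff.1 h
      obtain ⟨M', hM', h1⟩ := ih.1 M hM
      exact ⟨b :: M', by simp [hM'], h1.cons b⟩
    · obtain ⟨b, M, rfl, rfl, hM⟩ := List.map_eq_cons_iff.1 h
      obtain ⟨M', hM', h1⟩ := ih.2 M hM
      exact ⟨b :: M', by simp [hM'], h1.cons b⟩
  | far a b l hab =>
    refine ⟨fun L h => ?_, fun L h => ?_⟩
    · obtain ⟨a, M, rfl, rfl, hM⟩ := List.map_eq_cons_iff.1 h
      obtain ⟨b, M, rfl, rfl, rfl⟩ := List.map_eq_cons_iff.1 hM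
      exact ⟨b :: a :: M, rfl, .far a b M hab⟩
    · obtain ⟨a, M, rfl, rfl, hM⟩ := List.map_eq_cons_iff.1 h
      obtain ⟨b, M, rfl, rfl, rfl⟩ := List.map_eq_cons_iff.1 hM
      exact ⟨b :: a :: M, rfl, (far b a M hab).symm⟩
  | braid a b l hab =>
    refine ⟨fun L h => ?_, fun L h => ?_⟩
    · obtain ⟨a, M₁, rfl, rfl, h₁⟩ := List.map_eq_cons_iff.1 h
      obtain ⟨b, M₂, rfl, rfl, h₂⟩ := List.map_eq_cons_iff.1 h₁
      obtain ⟨c, M₃, rfl, hc, rfl⟩ := List.map_eq_cons_iff.1 h₂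
      obtain rfl := Fin.ext hc
      exact ⟨b :: c :: b :: M₃, rfl, .braid c b M₃ hab⟩
    · obtain ⟨b, M₁, rfl, rfl, h₁⟩ := List.map_eq_cons_iff.1 h
      obtain ⟨a, M₂, rfl, rfl, h₂⟩ := List.map_eq_cons_iff.1 h₁
      obtain ⟨c, M₃, rfl, hc, rfl⟩ := List.map_eq_cons_iff.1 h₂
      obtain rfl := Fin.ext hc
      exact ⟨a :: c :: a :: M₃, rfl, (braid a c M₃ hab).symm⟩

theorem slide_far {k j : ℕ} (n : ℕ) (t : List ℕ) (h : k + 1 < j) :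
    BraidEquiv id (k :: (List.range' j n ++ t)) (List.range' j n ++ k :: t) := by
  induction n generalizing j with
  | zero => exact .refl _
  | succ n ih => exact (far k j _ h).trans ((ih (by omega)).cons j)

/-- The letter `k + 1` commutes with `j, …, k - 1`, then `(k+1) k (k+1)` becomes `k (k+1) k`, and
the last `k` commutes with `k + 2, …`. It comes out lowered by one. -/
theorem slide_through {k j : ℕ} (n : ℕ) (t : List ℕ) (h : j ≤ k) (h' : k + 1 < j + n) :
    BraidEquiv id ((k + 1) :: (List.range' j n ++ t)) (List.range' j n ++ k :: t) := by
  induction n generalizing j with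
  | zero => omega
  | succ n ih =>
    rcases h.eq_or_lt with rfl | h
    · obtain ⟨n, rfl⟩ : ∃ p, n = p + 1 := ⟨n - 1, by omega⟩
      exact (braid (v := id) j (j + 1) _ rfl).symm.trans (((slide_far n t (by omega)).cons (j + 1)).cons j)
    · exact (far j (k + 1) _ (by simpa using h)).symm.trans ((ih h (by omega)).cons j)

end BraidEquiv

/-- The word is equivalent to one with two equal adjacent letters. -/
def HasSquare {α : Type*} (v : α → ℕ) (l : List α) : Prop :=
  ∃ a s b, BraidEquiv v l (a ++ s :: s :: b)

theorem HasSquare.append_left {α : Type*} {v : α → ℕ} (t : List α) {l : List α}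
    (h : HasSquare v l) : HasSquare v (t ++ l) := by
  obtain ⟨a, s, b, h⟩ := h
  exact ⟨t ++ a, s, b, by simpa using h.append_left t⟩

theorem HasSquare.of_equiv {α : Type*} {v : α → ℕ} {l l' : List α}
    (h : BraidEquiv v l l') (h' : HasSquare v l') : HasSquare v l := by
  obtain ⟨a, s, b, h'⟩ := h'
  exact ⟨a, s, b, h.trans h'⟩

/-- The normal form of words with letters `< n`. -/
def IsNormalWord : ℕ → List ℕ → Prop
  | 0, l => l = []
  | n + 1, l => ∃ j p l', j + p = n + 1 ∧ IsNormalWord n l' ∧ l = List.range' j p ++ l'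

theorem isNormalWord_nil (n : ℕ) : IsNormalWord n [] := by
  induction n with
  | zero => rfl
  | succ n ih => exact ⟨n + 1, 0, [], rfl, ih, rfl⟩

/-- A normal word is an ascending run `j, …, n` (empty if `j = n + 1`) followed by a normal word in
letters `< n`. A new first letter `k` slides past the run if `k + 1 < j`, extends it if `k + 1 = j`,
makes a square if `k = j`, and passes through as `k - 1` if `k > j`. When it comes out of the run it
is `< n`, and induction applies to the tail. -/
theorem IsNormalWord.cons {n k : ℕ} {l : List ℕ} (hl : IsNormalWord n l) (hk : k < n) :
    (∃ c, IsNormalWord n c ∧ BraidEquiv id (k :: l) c) ∨ HasSquare id (k :: l) := by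
  induction n generalizing k l with
  | zero => omega
  | succ n ih =>
    obtain ⟨j, p, l, hjp, hl, rfl⟩ := hl
    have key : ∀ k', k' < n →
        BraidEquiv id (k :: (List.range' j p ++ l)) (List.range' j p ++ k' :: l) →
        (∃ c, IsNormalWord (n + 1) c ∧ BraidEquiv id (k :: (List.range' j p ++ l)) c) ∨
          HasSquare id (k :: (List.range' j p ++ l)) := by
      intro k' hk' h
      rcases ih hl hk' with ⟨c, hc, h'⟩ | h'
      · exact .inl ⟨_, ⟨j, p, c, hjp, hc, rfl⟩, h.trans (h'.append_left _)⟩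
      · exact .inr (.of_equiv h (h'.append_left _))
    rcases lt_trichotomy (k + 1) j with h | rfl | h
    · exact key k (by omega) (.slide_far p l h)
    · exact .inl ⟨_, ⟨k, p + 1, l, by omega, hl, rfl⟩, .refl _⟩
    · rcases (Nat.lt_succ_iff.1 h).eq_or_lt with rfl | h
      · obtain ⟨p, rfl⟩ : ∃ q, p = q + 1 := ⟨p - 1, by omega⟩
        exact .inr ⟨[], j, _, .refl _⟩
      · obtain ⟨k, rfl⟩ : ∃ q, k = q + 1 := ⟨k - 1, by omega⟩
        exact key k (by omega) (.slide_through p l (by omega) (by omega))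

theorem exists_isNormalWord {n : ℕ} (l : List ℕ) (hl : ∀ k ∈ l, k < n) :
    (∃ c, IsNormalWord n c ∧ BraidEquiv id l c) ∨ HasSquare id l := by
  induction l with
  | nil => exact .inl ⟨[], isNormalWord_nil n, .refl _⟩
  | cons k l ih =>
    rcases ih fun a ha => hl a (by simp [ha]) with ⟨c, hc, h⟩ | h
    · rcases hc.cons (hl k (by simp)) with ⟨c', hc', h'⟩ | h'
      · exact .inl ⟨c', hc', (h.cons k).trans h'⟩
      · exact .inr (.of_equiv (h.cons k) h')
    · exact .inr (h.append_left [k])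

/-- The product of the simple transpositions of a word, as a permutation of `ℕ`. -/
def natWordProd (l : List ℕ) : Equiv.Perm ℕ := (l.map fun a => Equiv.swap a (a + 1)).prod

theorem natWordProd_cons (a : ℕ) (l : List ℕ) :
    natWordProd (a :: l) = Equiv.swap a (a + 1) * natWordProd l := by simp [natWordProd]

theorem natWordProd_append (l l' : List ℕ) :
    natWordProd (l ++ l') = natWordProd l * natWordProd l' := by simp [natWordProd]

theorem natWordProd_range' (j p : ℕ) : natWordProd (List.range' j p) (j + p) = j := by
  induction p generalizing j with
  | zero => simp [natWordProd]
  | succ p ih =>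
    have := ih (j + 1)
    rw [show j + 1 + p = j + (p + 1) by ring] at this
    rw [List.range'_succ, natWordProd_cons, Equiv.Perm.mul_apply, this, Equiv.swap_apply_right]

theorem IsNormalWord.lt {n : ℕ} {l : List ℕ} (hl : IsNormalWord n l) : ∀ k ∈ l, k < n := by
  induction n generalizing l with
  | zero => obtain rfl := hl; simp
  | succ n ih =>
    obtain ⟨j, p, l, hjp, hl, rfl⟩ := hl
    intro k hk
    rcases List.mem_append.1 hk with hk | hk
    · have := List.mem_range'_1.1 hk; omega
    · have := ih hl k hk; omega

theorem natWordProd_fix {n x : ℕ} (hx : n < x) (l : List ℕ) (hl : ∀ k ∈ l, k < n) :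
    natWordProd l x = x := by
  induction l with
  | nil => simp [natWordProd]
  | cons k l ih =>
    have := hl k (by simp)
    rw [natWordProd_cons, Equiv.Perm.mul_apply, ih fun a ha => hl a (by simp [ha]),
      Equiv.swap_apply_of_ne_of_ne] <;> omega

/-- The tail fixes `n + 1` and the run `j, …, n` sends `n + 1` to `j`. So the permutation determines
`j`, hence the run, which can be cancelled. -/
theorem IsNormalWord.unique {n : ℕ} {l l' : List ℕ} (hl : IsNormalWord n l)
    (hl' : IsNormalWord n l') (h : natWordProd l = natWordProd l') : l = l' := by
  induction n generalizing l l' with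
  | zero => exact hl.trans hl'.symm
  | succ n ih =>
    obtain ⟨j, p, l, hjp, hl, rfl⟩ := hl
    obtain ⟨j', p', l', hjp', hl', rfl⟩ := hl'
    have hj := congrArg (· (n + 1)) h
    simp only [natWordProd_append, Equiv.Perm.mul_apply,
      natWordProd_fix n.lt_add_one _ hl.lt,
      natWordProd_fix n.lt_add_one _ hl'.lt] at hj
    rw [← hjp, natWordProd_range', hjp, ← hjp', natWordProd_range'] at hj
    obtain rfl := hj
    obtain rfl : p = p' := by omega
    rw [natWordProd_append, natWordProd_append, mul_right_inj] at h
    rw [ih hl hl' h]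

/-! ### Matsumoto's theorem for words in the simple transpositions of the symmetric group -/

variable {m : ℕ}

theorem wordProd_cons (k : Fin (m - 1)) (l : List (Fin (m - 1))) :
    wordProd (k :: l) = simpleTr k * wordProd l := by simp [wordProd]

theorem wordProd_append (l l' : List (Fin (m - 1))) :
    wordProd (l ++ l') = wordProd l * wordProd l' := by simp [wordProd]

theorem val_simpleTr (k : Fin (m - 1)) (a : Fin m) :
    (simpleTr k a : ℕ) = Equiv.swap (k : ℕ) (k + 1) a := by
  simp only [simpleTr, Equiv.swap_apply_def, Fin.ext_iff, lpos, rpos]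
  split_ifs <;> rfl

theorem natWordProd_map_val (l : List (Fin (m - 1))) (a : Fin m) :
    natWordProd (l.map Fin.val) a = (wordProd l a : ℕ) := by
  induction l with
  | nil => rfl
  | cons k l ih =>
    rw [List.map_cons, natWordProd_cons, wordProd_cons, Equiv.Perm.mul_apply, ih,
      Equiv.Perm.mul_apply, val_simpleTr]

theorem natWordProd_map_val_eq {l l' : List (Fin (m - 1))} (h : wordProd l = wordProd l') :
    natWordProd (l.map Fin.val) = natWordProd (l'.map Fin.val) := by
  ext a
  by_cases ha : a < m
  · rw [natWordProd_map_val l ⟨a, ha⟩, natWordProd_map_val l' ⟨a, ha⟩, h]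
  -- Points outside `Fin m` are fixed. The empty word is treated apart because for `m = 0` the
  -- truncated `m - 1` is not below every such point; a letter in the word excludes that case.
  · have key : ∀ L : List (Fin (m - 1)), natWordProd (L.map Fin.val) a = a := fun L => by
      rcases L with _ | ⟨k, L⟩
      · rfl
      · refine natWordProd_fix (n := m - 1) ?_ _ ?_
        · have := k.2; omega
        · simp
    rw [key, key]

theorem simpleTr_mul_self (k : Fin (m - 1)) : simpleTr k * simpleTr k = 1 :=
  Equiv.swap_mul_self _ _

theorem simpleTr_commute {k l : Fin (m - 1)} (h : k.1 + 1 < l.1) :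
    simpleTr k * simpleTr l = simpleTr l * simpleTr k := by
  refine (Equiv.Perm.Disjoint.commute ?_).eq
  simp only [simpleTr]
  refine Equiv.Perm.disjoint_swap_swap ?_
  simp [lpos, rpos]
  omega

theorem simpleTr_braid {k l : Fin (m - 1)} (h : l.1 = k.1 + 1) :
    simpleTr k * (simpleTr l * simpleTr k) = simpleTr l * (simpleTr k * simpleTr l) := by
  ext a
  simp only [Equiv.Perm.mul_apply, val_simpleTr, h, Equiv.swap_apply_def]
  split_ifs <;> omega

theorem BraidEquiv.wordProd_eq {l l' : List (Fin (m - 1))} (h : BraidEquiv Fin.val l l') :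
    wordProd l = wordProd l' := by
  induction h with
  | refl => rfl
  | symm _ ih => exact ih.symm
  | trans _ _ ih ih' => exact ih.trans ih'
  | cons k _ ih => rw [wordProd_cons, wordProd_cons, ih]
  | far a b l h =>
    simp only [wordProd_cons]
    rw [← mul_assoc, simpleTr_commute h, mul_assoc]
  | braid a b l h =>
    simp only [wordProd_cons]
    simpa only [mul_assoc] using congrArg (· * wordProd l) (simpleTr_braid h)

theorem not_hasSquare {l : List (Fin (m - 1))} {w : Equiv.Perm (Fin m)}
    (hl : IsMinimalPresentation l w) : ¬ HasSquare Fin.val l := by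
  rintro ⟨a, s, b, h⟩
  have h1 := hl.2 (a ++ b) (by
    rw [← hl.1, h.wordProd_eq]
    simp only [wordProd_append, wordProd_cons]
    rw [← mul_assoc (simpleTr s), simpleTr_mul_self, one_mul])
  have h2 := h.length_eq
  simp only [List.length_append, List.length_cons] at h1 h2
  omega

theorem exists_isNormalWord_of_fin (l : List (Fin (m - 1))) :
    (∃ c : List (Fin (m - 1)), IsNormalWord (m - 1) (c.map Fin.val) ∧ BraidEquiv Fin.val l c) ∨
      HasSquare Fin.val l := by
  rcases exists_isNormalWord (n := m - 1) (l.map Fin.val) (by simp) with ⟨c, hc, h⟩ | ⟨a, s, b, h⟩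
  · obtain ⟨c, rfl, h'⟩ := h.lift.1 l rfl
    exact .inl ⟨c, hc, h'⟩
  · obtain ⟨c, hc, h'⟩ := h.lift.1 l rfl
    obtain ⟨a, M, rfl, rfl, hM⟩ := List.map_eq_append_iff.1 hc
    obtain ⟨s, M, rfl, rfl, hM⟩ := List.map_eq_cons_iff.1 hM
    obtain ⟨t, M, rfl, ht, rfl⟩ := List.map_eq_cons_iff.1 hM
    obtain rfl := Fin.ext ht
    exact .inr ⟨a, t, M, h'⟩

/-- Matsumoto's theorem, together with the fact that words which are not reduced can be shortened
after braid moves. -/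
theorem braidEquiv_or_hasSquare {l l' : List (Fin (m - 1))} {w : Equiv.Perm (Fin m)}
    (hl' : IsMinimalPresentation l' w) (hl : wordProd l = w) :
    BraidEquiv Fin.val l l' ∨ HasSquare Fin.val l := by
  rcases exists_isNormalWord_of_fin l with ⟨c, hc, h⟩ | h
  · rcases exists_isNormalWord_of_fin l' with ⟨c', hc', h'⟩ | h'
    · have := hc.unique hc' (natWordProd_map_val_eq (by
        rw [← h.wordProd_eq, ← h'.wordProd_eq, hl, hl'.1]))
      rw [Fin.val_injective.list_map this] at h
      exact .inl (h.trans h'.symm)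
    · exact absurd h' (not_hasSquare hl')
  · exact .inr h

end KL

namespace KL

universe u

variable {I : Type u} (Γ : SimpleGraph I) {ν : I →₀ ℕ}

/-! ### The defining relations as identities in the ring -/

section Relations

variable {Γ}

theorem mk_rel {a b : FreeAlgebra ℤ (Gen ν)} (h : Rel Γ ν a b) : mk Γ ν a = mk Γ ν b :=
  RingQuot.mkRingHom_rel h

theorem e_mul_self (i : Seq ν) : e Γ i * e Γ i = e Γ i := by
  simpa [e] using mk_rel (Rel.idem_mul_self (Γ := Γ) i)

theorem e_mul_ne {i j : Seq ν} (h : i ≠ j) : e Γ i * e Γ j = 0 := by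
  simpa [e] using mk_rel (Rel.idem_mul_ne (Γ := Γ) i j h)

theorem sum_e : ∑ i : Seq ν, e Γ i = 1 := by
  simpa [e] using mk_rel (Rel.sum_idem (Γ := Γ) (ν := ν))

theorem x_mul_e (k : Fin (len ν)) (i : Seq ν) : x Γ k i * e Γ i = x Γ k i := by
  simpa [e, x] using mk_rel (Rel.dot_bot (Γ := Γ) k i)

theorem e_mul_x (k : Fin (len ν)) (i : Seq ν) : e Γ i * x Γ k i = x Γ k i := by
  simpa [e, x] using mk_rel (Rel.dot_top (Γ := Γ) k i)

theorem δ_mul_e (k : Fin (len ν - 1)) (i : Seq ν) : δ Γ k i * e Γ i = δ Γ k i := by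
  simpa [e, δ] using mk_rel (Rel.cross_bot (Γ := Γ) k i)

theorem e_mul_δ (k : Fin (len ν - 1)) (i : Seq ν) : e Γ (i.swap k) * δ Γ k i = δ Γ k i := by
  simpa [e, δ] using mk_rel (Rel.cross_top (Γ := Γ) k i)

theorem x_comm (k l : Fin (len ν)) (i : Seq ν) : x Γ k i * x Γ l i = x Γ l i * x Γ k i := by
  simpa [x] using mk_rel (Rel.dot_dot (Γ := Γ) k l i)

theorem δ_mul_x {k : Fin (len ν - 1)} {l : Fin (len ν)} (i : Seq ν) (hl : l ≠ lpos k)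
    (hr : l ≠ rpos k) : δ Γ k i * x Γ l i = x Γ l (i.swap k) * δ Γ k i := by
  simpa [x, δ] using mk_rel (Rel.cross_dot (Γ := Γ) k l i hl hr)

theorem δ_comm {k l : Fin (len ν - 1)} (i : Seq ν) (h : k.1 + 1 < l.1) :
    δ Γ k (i.swap l) * δ Γ l i = δ Γ l (i.swap k) * δ Γ k i := by
  simpa [δ] using mk_rel (Rel.cross_cross (Γ := Γ) k l i h)

theorem δ_sq_eq {k : Fin (len ν - 1)} {i : Seq ν} (h : i.vertex (lpos k) = i.vertex (rpos k)) :
    δ Γ k (i.swap k) * δ Γ k i = 0 := by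
  simpa [δ] using mk_rel (Rel.double_eq (Γ := Γ) k i h)

theorem δ_sq_far {k : Fin (len ν - 1)} {i : Seq ν} (hne : i.vertex (lpos k) ≠ i.vertex (rpos k))
    (h : ¬ Γ.Adj (i.vertex (lpos k)) (i.vertex (rpos k))) :
    δ Γ k (i.swap k) * δ Γ k i = e Γ i := by
  simpa [δ, e] using mk_rel (Rel.double_far (Γ := Γ) k i hne h)

theorem δ_sq_adj {k : Fin (len ν - 1)} {i : Seq ν}
    (h : Γ.Adj (i.vertex (lpos k)) (i.vertex (rpos k))) :
    δ Γ k (i.swap k) * δ Γ k i = x Γ (lpos k) i + x Γ (rpos k) i := by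
  simpa [δ, x] using mk_rel (Rel.double_adj (Γ := Γ) k i h)

/-- The spanning argument only needs that the error of a slide has no crossing, so the cases of
equal and different labels are merged into a disjunction. The same is done in `x_rpos_mul_δ` and
`δ_braid`. -/
theorem x_lpos_mul_δ (k : Fin (len ν - 1)) (i : Seq ν) :
    x Γ (lpos k) (i.swap k) * δ Γ k i = δ Γ k i * x Γ (rpos k) i ∨
    x Γ (lpos k) (i.swap k) * δ Γ k i = δ Γ k i * x Γ (rpos k) i + e Γ i := by
  by_cases h : i.vertex (lpos k) = i.vertex (rpos k)
  · right
    have := mk_rel (Rel.slide_eq_left (Γ := Γ) k i h)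
    simp only [map_sub, map_mul] at this
    exact sub_eq_iff_eq_add'.1 this
  · left
    simpa [δ, x] using mk_rel (Rel.slide_ne_left (Γ := Γ) k i h)

theorem x_rpos_mul_δ (k : Fin (len ν - 1)) (i : Seq ν) :
    x Γ (rpos k) (i.swap k) * δ Γ k i = δ Γ k i * x Γ (lpos k) i ∨
    x Γ (rpos k) (i.swap k) * δ Γ k i = δ Γ k i * x Γ (lpos k) i - e Γ i := by
  by_cases h : i.vertex (lpos k) = i.vertex (rpos k)
  · right
    have := mk_rel (Rel.slide_eq_right (Γ := Γ) k i h)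
    simp only [map_sub, map_mul] at this
    exact eq_sub_of_add_eq' (sub_eq_iff_eq_add.1 this).symm
  · left
    simpa [δ, x] using mk_rel (Rel.slide_ne_right (Γ := Γ) k i h)

theorem δ_braid {k l : Fin (len ν - 1)} (hkl : l.1 = k.1 + 1) (i : Seq ν) :
    δ Γ k ((i.swap k).swap l) * δ Γ l (i.swap k) * δ Γ k i -
        δ Γ l ((i.swap l).swap k) * δ Γ k (i.swap l) * δ Γ l i = 0 ∨
    δ Γ k ((i.swap k).swap l) * δ Γ l (i.swap k) * δ Γ k i -
        δ Γ l ((i.swap l).swap k) * δ Γ k (i.swap l) * δ Γ l i = e Γ i := by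
  by_cases h : i.vertex (lpos k) = i.vertex (rpos l) ∧
      Γ.Adj (i.vertex (lpos k)) (i.vertex (rpos k))
  · right
    simpa [δ, e] using mk_rel (Rel.braid_hard (Γ := Γ) k l hkl i h.1 h.2)
  · left
    rw [sub_eq_zero]
    simpa [δ] using mk_rel (Rel.braid_easy (Γ := Γ) k l hkl i h)

end Relations

/-! ### Polynomials in the dots -/

section Dots

/-- The commuting dots on the sequence `i` generate a commutative ring. -/
theorem dots_commute (i : Seq ν) :
    ∀ a ∈ Set.range fun k => x Γ k i, ∀ b ∈ Set.range fun k => x Γ k i, a * b = b * a := by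
  rintro _ ⟨k, rfl⟩ _ ⟨l, rfl⟩
  exact x_comm k l i

open scoped IsMulCommutative in
/-- Evaluation of polynomials at the dots on the sequence `i`. -/
noncomputable def dotEval (i : Seq ν) : MvPolynomial (Fin (len ν)) ℤ →ₐ[ℤ] R Γ ν :=
  -- `aeval` needs a commutative target, so the evaluation takes place in the subalgebra generated
  -- by the dots.
  have := Algebra.isMulCommutative_adjoin ℤ (dots_commute Γ i)
  (Algebra.adjoin ℤ (Set.range fun k => x Γ k i)).val.comp
    (MvPolynomial.aeval fun k => ⟨x Γ k i, Algebra.subset_adjoin ⟨k, rfl⟩⟩)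

open scoped IsMulCommutative in
theorem dotEval_X (i : Seq ν) (k : Fin (len ν)) : dotEval Γ i (MvPolynomial.X k) = x Γ k i := by
  have := Algebra.isMulCommutative_adjoin ℤ (dots_commute Γ i)
  simp [dotEval]

theorem dotEval_monomial (i : Seq ν) (u : Fin (len ν) →₀ ℕ) :
    dotEval Γ i (MvPolynomial.monomial u 1) = dotMonomial Γ i u := by
  have : (MvPolynomial.monomial u 1 : MvPolynomial (Fin (len ν)) ℤ) =
      (List.ofFn fun k => MvPolynomial.X k ^ u k).prod := by
    rw [List.prod_ofFn, MvPolynomial.monomial_eq, Finsupp.prod_fintype _ _ (by simp)]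
    simp
  rw [this, map_list_prod, List.map_ofFn, dotMonomial]
  congr 2
  ext k
  simp [dotEval_X]

variable {Γ}

/-- Constants are evaluated at multiples of the unit of the whole ring, not of `1_i`. The idempotent
therefore has to be supplied separately and moved past the polynomial. -/
theorem e_commute_dotEval (i : Seq ν) (p : MvPolynomial (Fin (len ν)) ℤ) :
    e Γ i * dotEval Γ i p = dotEval Γ i p * e Γ i := by
  induction p using MvPolynomial.induction_on with
  | C a => simpa using (Int.cast_commute a (e Γ i)).symm.eq
  | add p q hp hq => rw [map_add, mul_add, add_mul, hp, hq]
  | mul_X p k hp => rw [map_mul, ← mul_assoc, hp, mul_assoc, mul_assoc, dotEval_X, x_mul_e, e_mul_x]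

end Dots

/-! ### Spanning by reduced words with dots at the bottom -/

section Span

variable {Γ}

theorem Seq.perm_one (i : Seq ν) : i.perm 1 = i := rfl

theorem Seq.perm_mul (v w : Equiv.Perm (Fin (len ν))) (i : Seq ν) :
    i.perm (v * w) = (i.perm w).perm v := rfl

theorem Seq.act_eq_perm (i : Seq ν) (l : List (Fin (len ν - 1))) :
    i.act l = i.perm (wordProd l) := by
  induction l with
  | nil => rfl
  | cons k l ih => rw [wordProd_cons, Seq.perm_mul, ← ih]; rfl

theorem hat_cons (k : Fin (len ν - 1)) (l : List (Fin (len ν - 1))) (i : Seq ν) :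
    hat Γ (k :: l) i = δ Γ k (i.act l) * hat Γ l i := rfl

theorem e_mul_hat (l : List (Fin (len ν - 1))) (i : Seq ν) :
    e Γ (i.act l) * hat Γ l i = hat Γ l i := by
  cases l with
  | nil => exact e_mul_self i
  | cons k l => rw [hat_cons, ← mul_assoc]; exact congrArg (· * _) (e_mul_δ _ _)

theorem hat_mul_e (l : List (Fin (len ν - 1))) (i : Seq ν) :
    hat Γ l i * e Γ i = hat Γ l i := by
  induction l with
  | nil => exact e_mul_self i
  | cons k l ih => rw [hat_cons, mul_assoc, ih]

theorem e_mul_hat_ne {l : List (Fin (len ν - 1))} {i j : Seq ν} (h : j ≠ i.act l) :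
    e Γ j * hat Γ l i = 0 := by
  rw [← e_mul_hat, ← mul_assoc, e_mul_ne h, zero_mul]

variable (Γ) in
/-- The span of the diagrams with bottom sequence `i` formed by dots below fewer than `n`
crossings. -/
noncomputable def lowSpan (i : Seq ν) (n : ℕ) : Submodule ℤ (R Γ ν) :=
  Submodule.span ℤ {r | ∃ l p, l.length < n ∧ r = hat Γ l i * dotEval Γ i p}

theorem hat_mem_lowSpan {i : Seq ν} {n : ℕ} {l : List (Fin (len ν - 1))} (h : l.length < n)
    (p : MvPolynomial (Fin (len ν)) ℤ) : hat Γ l i * dotEval Γ i p ∈ lowSpan Γ i n :=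
  Submodule.subset_span ⟨l, p, h, rfl⟩

theorem hat_mem_lowSpan' {i : Seq ν} {n : ℕ} {l : List (Fin (len ν - 1))} (h : l.length < n) :
    hat Γ l i ∈ lowSpan Γ i n := by
  simpa using hat_mem_lowSpan h 1

theorem lowSpan_mono (i : Seq ν) {n n' : ℕ} (h : n ≤ n') : lowSpan Γ i n ≤ lowSpan Γ i n' :=
  Submodule.span_mono fun _ ⟨l, p, hl, hr⟩ => ⟨l, p, hl.trans_le h, hr⟩

theorem mul_dotEval_mem_lowSpan {i : Seq ν} {n : ℕ} {r : R Γ ν} (hr : r ∈ lowSpan Γ i n)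
    (p : MvPolynomial (Fin (len ν)) ℤ) : r * dotEval Γ i p ∈ lowSpan Γ i n := by
  induction hr using Submodule.span_induction with
  | mem r hr' =>
    obtain ⟨l, q, hl, rfl⟩ := hr'
    rw [mul_assoc, ← map_mul]
    exact hat_mem_lowSpan hl _
  | zero => simp
  | add r s _ _ hr hs => rw [add_mul]; exact add_mem hr hs
  | smul c r _ hr => rw [smul_mul_assoc]; exact Submodule.smul_mem _ c hr

/-- Dots at the bottom are harmless under left multiplication, so only dotless diagrams have to be
tested. -/
theorem mul_mem_lowSpan_of {i : Seq ν} {n n' : ℕ} {a : R Γ ν}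
    (h : ∀ l : List (Fin (len ν - 1)), l.length < n → a * hat Γ l i ∈ lowSpan Γ i n')
    {r : R Γ ν} (hr : r ∈ lowSpan Γ i n) : a * r ∈ lowSpan Γ i n' := by
  induction hr using Submodule.span_induction with
  | mem r hr =>
    obtain ⟨l, p, hl, rfl⟩ := hr
    rw [← mul_assoc]
    exact mul_dotEval_mem_lowSpan (h l hl) p
  | zero => simp
  | add r s _ _ hr hs => rw [mul_add]; exact add_mem hr hs
  | smul c r _ hr => rw [mul_smul_comm]; exact Submodule.smul_mem _ c hr

theorem e_mul_mem_lowSpan (j : Seq ν) {i : Seq ν} {n : ℕ} {r : R Γ ν} (hr : r ∈ lowSpan Γ i n) :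
    e Γ j * r ∈ lowSpan Γ i n := by
  refine mul_mem_lowSpan_of (fun l hl => ?_) hr
  by_cases h : j = i.act l
  · rw [h, e_mul_hat]; exact hat_mem_lowSpan' hl
  · rw [e_mul_hat_ne h]; exact zero_mem _

theorem δ_mul_mem_lowSpan (k : Fin (len ν - 1)) (j : Seq ν) {i : Seq ν} {n : ℕ} {r : R Γ ν}
    (hr : r ∈ lowSpan Γ i n) : δ Γ k j * r ∈ lowSpan Γ i (n + 1) := by
  refine mul_mem_lowSpan_of (fun l hl => ?_) hr
  by_cases h : j = i.act l
  · rw [h, ← hat_cons]; exact hat_mem_lowSpan' (by simpa using hl)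
  · rw [← δ_mul_e, mul_assoc, e_mul_hat_ne h, mul_zero]; exact zero_mem _

/-- A dot on top slides down one crossing at a time; each error term has lost the crossing just
passed, so the bound on crossings is kept. -/
theorem x_mul_hat_mem_lowSpan (k : Fin (len ν)) {i : Seq ν} {n : ℕ} (l : List (Fin (len ν - 1)))
    (hl : l.length < n) : x Γ k (i.act l) * hat Γ l i ∈ lowSpan Γ i n := by
  induction l generalizing n k with
  | nil =>
    change x Γ k i * e Γ i ∈ _
    rw [x_mul_e, ← e_mul_x, ← dotEval_X]
    exact hat_mem_lowSpan hl _
  | cons c l ih =>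
    obtain ⟨n, rfl⟩ : ∃ q, n = q + 1 := ⟨n - 1, by omega⟩
    have hl : l.length < n := by simpa using hl
    rw [hat_cons, ← mul_assoc]
    change x Γ k ((i.act l).swap c) * _ * _ ∈ _
    have key : ∀ k', δ Γ c (i.act l) * x Γ k' (i.act l) * hat Γ l i ∈ lowSpan Γ i (n + 1) :=
      fun k' => by rw [mul_assoc]; exact δ_mul_mem_lowSpan _ _ (ih k' hl)
    have key' : e Γ (i.act l) * hat Γ l i ∈ lowSpan Γ i (n + 1) := by
      rw [e_mul_hat]; exact hat_mem_lowSpan' (by omega)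
    by_cases h1 : k = lpos c
    · subst h1
      rcases x_lpos_mul_δ (Γ := Γ) c (i.act l) with h | h <;> rw [h]
      · exact key _
      · rw [add_mul]; exact add_mem (key _) key'
    by_cases h2 : k = rpos c
    · subst h2
      rcases x_rpos_mul_δ (Γ := Γ) c (i.act l) with h | h <;> rw [h]
      · exact key _
      · rw [sub_mul]; exact sub_mem (key _) key'
    · rw [← δ_mul_x _ h1 h2]; exact key _

theorem x_mul_mem_lowSpan (k : Fin (len ν)) (j : Seq ν) {i : Seq ν} {n : ℕ} {r : R Γ ν}
    (hr : r ∈ lowSpan Γ i n) : x Γ k j * r ∈ lowSpan Γ i n := by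
  refine mul_mem_lowSpan_of (fun l hl => ?_) hr
  by_cases h : j = i.act l
  · rw [h]; exact x_mul_hat_mem_lowSpan k l hl
  · rw [← x_mul_e, mul_assoc, e_mul_hat_ne h, mul_zero]; exact zero_mem _

/-- Words that are equivalent under braid moves give the same element up to fewer crossings. -/
theorem BraidEquiv.hat_sub_mem {l l' : List (Fin (len ν - 1))} (h : BraidEquiv Fin.val l l')
    (i : Seq ν) : hat Γ l i - hat Γ l' i ∈ lowSpan Γ i l.length := by
  induction h with
  | refl => simp
  | symm h ih => rw [← h.length_eq, ← neg_sub]; exact neg_mem ih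
  | trans h _ ih ih' =>
    rw [← h.length_eq] at ih'
    simpa using add_mem ih ih'
  | cons k h ih =>
    -- Equivalent words have the same product, hence the same top sequence, so the same crossing is
    -- put on both diagrams.
    rw [hat_cons, hat_cons, Seq.act_eq_perm, Seq.act_eq_perm, ← h.wordProd_eq, ← mul_sub]
    exact δ_mul_mem_lowSpan _ _ ih
  | far a b l h =>
    rw [hat_cons, hat_cons, hat_cons, hat_cons, ← mul_assoc, ← mul_assoc]
    change δ Γ a ((i.act l).swap b) * δ Γ b (i.act l) * _ -
      δ Γ b ((i.act l).swap a) * δ Γ a (i.act l) * _ ∈ _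
    rw [δ_comm _ h, sub_self]
    exact zero_mem _
  | braid a b l h =>
    simp only [hat_cons, ← mul_assoc]
    change δ Γ a (((i.act l).swap a).swap b) * δ Γ b ((i.act l).swap a) * δ Γ a (i.act l) * _ -
      δ Γ b (((i.act l).swap b).swap a) * δ Γ a ((i.act l).swap b) * δ Γ b (i.act l) * _ ∈ _
    rw [← sub_mul]
    rcases δ_braid (Γ := Γ) h (i.act l) with h | h <;> rw [h]
    · simp
    · rw [e_mul_hat]; exact hat_mem_lowSpan' (by simp only [List.length_cons]; omega)

theorem hat_append_mem {l : List (Fin (len ν - 1))} {i : Seq ν} {n : ℕ}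
    (a : List (Fin (len ν - 1))) (h : hat Γ l i ∈ lowSpan Γ i n) :
    hat Γ (a ++ l) i ∈ lowSpan Γ i (a.length + n) := by
  induction a with
  | nil => simpa using h
  | cons k a ih =>
    rw [List.cons_append, hat_cons, List.length_cons, add_right_comm]
    exact δ_mul_mem_lowSpan _ _ ih

/-- After braid moves a double crossing appears. It equals `0`, `1` or a sum of two dots, none of
which has a crossing. -/
theorem HasSquare.hat_mem {l : List (Fin (len ν - 1))} (h : HasSquare Fin.val l) (i : Seq ν) :
    hat Γ l i ∈ lowSpan Γ i l.length := by
  obtain ⟨a, s, b, h⟩ := h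
  rw [← sub_add_cancel (hat Γ l i)]
  refine add_mem (h.hat_sub_mem i) ?_
  have hb : hat Γ b i ∈ lowSpan Γ i (b.length + 1) := hat_mem_lowSpan' (Nat.lt_succ_self _)
  have : hat Γ (s :: s :: b) i ∈ lowSpan Γ i (b.length + 1) := by
    rw [hat_cons, hat_cons, ← mul_assoc]
    change δ Γ s ((i.act b).swap s) * δ Γ s (i.act b) * _ ∈ _
    by_cases h1 : (i.act b).vertex (lpos s) = (i.act b).vertex (rpos s)
    · rw [δ_sq_eq h1, zero_mul]; exact zero_mem _
    by_cases h2 : Γ.Adj ((i.act b).vertex (lpos s)) ((i.act b).vertex (rpos s))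
    · rw [δ_sq_adj h2, add_mul]
      exact add_mem (x_mul_mem_lowSpan _ _ hb) (x_mul_mem_lowSpan _ _ hb)
    · rw [δ_sq_far h1 h2]; exact e_mul_mem_lowSpan _ hb
  refine lowSpan_mono i ?_ (hat_append_mem a this)
  rw [h.length_eq]
  simp

/-- A word is braid equivalent to the chosen reduced word, with an error of fewer crossings, or it
contains a square after braid moves and is itself a combination of diagrams with fewer crossings.
Induction on the number of crossings handles both. -/
theorem lowSpan_le_span (word : Equiv.Perm (Fin (len ν)) → List (Fin (len ν - 1)))
    (hword : ∀ w, IsMinimalPresentation (word w) w) (i : Seq ν) (n : ℕ) :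
    lowSpan Γ i n ≤ Submodule.span ℤ {r | ∃ w p, r = hat Γ (word w) i * dotEval Γ i p} := by
  induction n with
  | zero => exact Submodule.span_le.2 fun r ⟨_, _, h, _⟩ => absurd h (Nat.not_lt_zero _)
  | succ n ih =>
    refine Submodule.span_le.2 ?_
    rintro r ⟨l, p, h, rfl⟩
    rw [SetLike.mem_coe]
    rcases braidEquiv_or_hasSquare (hword (wordProd l)) rfl with h' | h'
    · rw [← sub_add_cancel (hat Γ l i), add_mul]
      refine add_mem (ih (mul_dotEval_mem_lowSpan ?_ p)) (Submodule.subset_span ⟨wordProd l, p, rfl⟩)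
      exact lowSpan_mono i (Nat.lt_succ_iff.1 h) (h'.hat_sub_mem i)
    · exact ih (mul_dotEval_mem_lowSpan (lowSpan_mono i (Nat.lt_succ_iff.1 h) (h'.hat_mem i)) p)

theorem R.induction {P : R Γ ν → Prop} (int : ∀ n : ℤ, P n) (he : ∀ i, P (e Γ i))
    (hx : ∀ k i, P (x Γ k i)) (hδ : ∀ k i, P (δ Γ k i)) (add : ∀ r s, P r → P s → P (r + s))
    (mul : ∀ r s, P r → P s → P (r * s)) (r : R Γ ν) : P r := by
  obtain ⟨a, rfl⟩ := RingQuot.mkRingHom_surjective (Rel Γ ν) r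
  change P (mk Γ ν a)
  induction a using FreeAlgebra.induction with
  | grade0 n => simpa using int n
  | grade1 g =>
    cases g with
    | idem i => exact he i
    | dot k i => exact hx k i
    | cross k i => exact hδ k i
  | mul a b ha hb => rw [map_mul]; exact mul _ _ ha hb
  | add a b ha hb => rw [map_add]; exact add _ _ ha hb

/-- The union of the filtration is stable under left multiplication. The bound has to be allowed to
grow, since each crossing raises it by one. -/
theorem exists_mul_mem_lowSpan (i : Seq ν) (a : R Γ ν) :
    ∀ n, ∀ r ∈ lowSpan Γ i n, ∃ n', a * r ∈ lowSpan Γ i n' := by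
  induction a using R.induction with
  | int m =>
    exact fun n r hr => ⟨n, by rw [← zsmul_eq_mul]; exact Submodule.smul_mem _ m hr⟩
  | he j => exact fun n r hr => ⟨n, e_mul_mem_lowSpan j hr⟩
  | hx k j => exact fun n r hr => ⟨n, x_mul_mem_lowSpan k j hr⟩
  | hδ k j => exact fun n r hr => ⟨n + 1, δ_mul_mem_lowSpan k j hr⟩
  | add a b ha hb =>
    intro n r hr
    obtain ⟨n₁, h₁⟩ := ha n r hr
    obtain ⟨n₂, h₂⟩ := hb n r hr
    refine ⟨max n₁ n₂, ?_⟩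
    rw [add_mul]
    exact add_mem (lowSpan_mono i (le_max_left _ _) h₁) (lowSpan_mono i (le_max_right _ _) h₂)
  | mul a b ha hb =>
    intro n r hr
    obtain ⟨n₁, h₁⟩ := hb n r hr
    obtain ⟨n₂, h₂⟩ := ha n₁ _ h₁
    exact ⟨n₂, by rwa [mul_assoc]⟩

theorem mul_e_mem_span (word : Equiv.Perm (Fin (len ν)) → List (Fin (len ν - 1)))
    (hword : ∀ w, IsMinimalPresentation (word w) w) (i : Seq ν) (a : R Γ ν) :
    a * e Γ i ∈ Submodule.span ℤ {r | ∃ w p, r = hat Γ (word w) i * dotEval Γ i p} := by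
  obtain ⟨n, hn⟩ := exists_mul_mem_lowSpan i a 1 (e Γ i) (hat_mem_lowSpan' (l := []) one_pos)
  exact lowSpan_le_span word hword i n hn

end Span

end KL

namespace KL

universe u

open MvPolynomial

/-! ### Divided differences and permutations of rational functions -/

section DividedDifference

variable {m : ℕ}

/-- Modulo `x_k - x_{k+1}` the two exchanged variables coincide, so `s_k` induces the identity on
the quotient. -/
theorem X_sub_X_dvd (k : Fin (m - 1)) (f : MvPolynomial (Fin m) ℤ) :
    (X (lpos k) - X (rpos k) : MvPolynomial (Fin m) ℤ) ∣ f - sPol k f := by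
  rw [← Ideal.mem_span_singleton, ← Ideal.Quotient.mk_eq_mk_iff_sub_mem]
  set J := Ideal.span {(X (lpos k) - X (rpos k) : MvPolynomial (Fin m) ℤ)}
  have h : Ideal.Quotient.mk J (X (lpos k)) = Ideal.Quotient.mk J (X (rpos k)) :=
    (Ideal.Quotient.mk_eq_mk_iff_sub_mem _ _).2 (Ideal.mem_span_singleton_self _)
  have : Ideal.Quotient.mkₐ ℤ J = (Ideal.Quotient.mkₐ ℤ J).comp (rename (simpleTr k)) := by
    refine MvPolynomial.algHom_ext fun a => ?_
    simp only [AlgHom.comp_apply, rename_X, Ideal.Quotient.mkₐ_eq_mk, simpleTr,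
      Equiv.swap_apply_def]
    split_ifs with h1 h2
    · rw [h1, h]
    · rw [h2, h]
    · rfl
  exact DFunLike.congr_fun this f

theorem lpos_ne_rpos (k : Fin (m - 1)) : lpos k ≠ rpos k := by
  simp [lpos, rpos, Fin.ext_iff]

theorem X_sub_X_ne_zero {a b : Fin m} (h : a ≠ b) :
    (X a - X b : MvPolynomial (Fin m) ℤ) ≠ 0 :=
  sub_ne_zero.2 fun h' => h (X_injective h')

/-- The divided difference operator `f ↦ (f - s_k f) / (x_k - x_{k+1})`. -/
noncomputable def divDiff (k : Fin (m - 1)) :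
    MvPolynomial (Fin m) ℤ →ₗ[ℤ] MvPolynomial (Fin m) ℤ where
  toFun f := (X_sub_X_dvd k f).choose
  map_add' f g := by
    -- The chosen quotient is unique in a domain, so linearity may be checked after multiplying by
    -- `x_k - x_{k+1}`.
    apply mul_left_cancel₀ (X_sub_X_ne_zero (lpos_ne_rpos k))
    rw [mul_add, ← (X_sub_X_dvd k _).choose_spec, ← (X_sub_X_dvd k _).choose_spec,
      ← (X_sub_X_dvd k _).choose_spec]
    simp only [sPol, map_add]
    ring
  map_smul' c f := by
    apply mul_left_cancel₀ (X_sub_X_ne_zero (lpos_ne_rpos k))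
    rw [mul_smul_comm, ← (X_sub_X_dvd k _).choose_spec, ← (X_sub_X_dvd k _).choose_spec]
    simp only [sPol, map_smul, smul_sub, RingHom.id_apply]

theorem mul_divDiff (k : Fin (m - 1)) (f : MvPolynomial (Fin m) ℤ) :
    (X (lpos k) - X (rpos k)) * divDiff k f = f - sPol k f :=
  (X_sub_X_dvd k f).choose_spec.symm

/-- The field of rational functions. -/
abbrev RatField (m : ℕ) : Type := FractionRing (MvPolynomial (Fin m) ℤ)

/-- The inclusion of the polynomials into the rational functions. -/
noncomputable abbrev toRat (m : ℕ) : MvPolynomial (Fin m) ℤ →+* RatField m := algebraMap _ _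

theorem toRat_injective : Function.Injective (toRat m) := IsFractionRing.injective _ _

/-- The action of permutations of the variables on rational functions. -/
noncomputable def ratPerm (w : Equiv.Perm (Fin m)) : RatField m →+* RatField m :=
  (IsFractionRing.ringEquivOfRingEquiv (K := RatField m) (L := RatField m)
    (renameEquiv ℤ w).toRingEquiv).toRingHom

theorem ratPerm_toRat (w : Equiv.Perm (Fin m)) (f : MvPolynomial (Fin m) ℤ) :
    ratPerm w (toRat m f) = toRat m (rename w f) := by
  simp [ratPerm, toRat]

theorem ratPerm_ratPerm (v w : Equiv.Perm (Fin m)) (f : RatField m) :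
    ratPerm v (ratPerm w f) = ratPerm (v * w) f := by
  have : (ratPerm v).comp (ratPerm w) = ratPerm (v * w) := by
    refine IsLocalization.ringHom_ext (nonZeroDivisors (MvPolynomial (Fin m) ℤ)) ?_
    refine MvPolynomial.ringHom_ext (fun r => ?_) fun a => ?_
    · simp
    · simp [ratPerm_toRat]
  exact DFunLike.congr_fun this f

theorem ratPerm_one (f : RatField m) : ratPerm 1 f = f := by
  have : ratPerm (1 : Equiv.Perm (Fin m)) = RingHom.id _ := by
    refine IsLocalization.ringHom_ext (nonZeroDivisors (MvPolynomial (Fin m) ℤ)) ?_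
    refine MvPolynomial.ringHom_ext (fun r => ?_) fun a => ?_
    · simp
    · simp [ratPerm_toRat]
  exact DFunLike.congr_fun this f

/-- The variables as rational functions. -/
noncomputable def ratX (a : Fin m) : RatField m := toRat m (X a)

theorem ratPerm_ratX (w : Equiv.Perm (Fin m)) (a : Fin m) : ratPerm w (ratX a) = ratX (w a) := by
  rw [ratX, ratPerm_toRat, rename_X, ratX]

theorem ratX_sub_ne_zero {a b : Fin m} (h : a ≠ b) : ratX a - ratX b ≠ 0 := by
  rw [ratX, ratX, ← map_sub, map_ne_zero_iff _ toRat_injective]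
  exact X_sub_X_ne_zero h

end DividedDifference

/-! ### The relations between crossings as identities in a field -/

section CrossFormula

variable {I : Type u} {Γ : SimpleGraph I} (o : Orientation Γ)

theorem Orientation.not_arrow_self (p : I) : ¬ o.arrow p p := fun h => o.asymm p p h h

open Classical in
/-- The factor by which a crossing of strands with different labels differs from the exchange of
variables. -/
noncomputable def edgeFactor {K : Type*} [Field K] (p q : I) (a b : K) : K :=
  if o.arrow p q then a + b else 1

open Classical in
/-- The action of a crossing of strands labelled `p`, `q` on a function `g`, where `g'` is the
function obtained by exchanging the variables `a`, `b`. -/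
noncomputable def crossFormula {K : Type*} [Field K] (p q : I) (a b g g' : K) : K :=
  if p = q then (g - g') / (a - b) else edgeFactor o p q a b * g'

variable {K : Type*} [Field K]

theorem edgeFactor_comm (p q : I) (a b : K) : edgeFactor o p q a b = edgeFactor o p q b a := by
  simp only [edgeFactor, add_comm]

theorem map_edgeFactor (σ : K →+* K) (p q : I) (a b : K) :
    σ (edgeFactor o p q a b) = edgeFactor o p q (σ a) (σ b) := by
  unfold edgeFactor
  split_ifs <;> simp

theorem map_crossFormula (σ : K →+* K) (p q : I) (a b g g' : K) :
    σ (crossFormula o p q a b g g') = crossFormula o p q (σ a) (σ b) (σ g) (σ g') := by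
  unfold crossFormula
  split_ifs <;> simp [map_edgeFactor]

theorem crossFormula_self (p : I) (a b g g' : K) :
    crossFormula o p p a b g g' = (g - g') / (a - b) := by simp [crossFormula]

theorem crossFormula_ne {p q : I} (h : p ≠ q) (a b g g' : K) :
    crossFormula o p q a b g g' = edgeFactor o p q a b * g' := by simp [crossFormula, h]

theorem edgeFactor_ne_zero {p q : I} {a b : K} (h : a + b ≠ 0) : edgeFactor o p q a b ≠ 0 := by
  unfold edgeFactor
  split_ifs <;> simp [h]

theorem edgeFactor_mul_of_adj {p q : I} (h : Γ.Adj p q) (a b : K) :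
    edgeFactor o p q a b * edgeFactor o q p a b = a + b := by
  rcases (o.adj_iff p q).1 h with h | h <;> simp [edgeFactor, h, o.asymm _ _ h]

theorem edgeFactor_of_not_adj {p q : I} (h : ¬ Γ.Adj p q) (a b : K) :
    edgeFactor o p q a b = 1 := by
  rw [edgeFactor, if_neg fun h' => h ((o.adj_iff p q).2 (.inl h'))]

/-- The values stand for `g, s g, t g, s t g` with `s, t` commuting; as independent letters they
already satisfy the identity. -/
theorem crossFormula_comm (p q r s : I) (a b c d g g₁ g₂ g₁₂ : K) :
    crossFormula o p q a b (crossFormula o r s c d g g₂) (crossFormula o r s c d g₁ g₁₂) =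
      crossFormula o r s c d (crossFormula o p q a b g g₁) (crossFormula o p q a b g₂ g₁₂) := by
  unfold crossFormula
  split_ifs <;> ring

-- With `s`, `t` the two adjacent transpositions, `g₁, g₂, g₁₂, g₂₁, g₀` stand for `s g, t g, s t g,
-- t s g, s t s g`, and the identity holds for them as independent letters. The exceptional case is
-- `p = r` adjacent to `q`: the terms in `g₀` cancel and `g` gets the coefficient `((a + b) - (b +
-- c)) / (a - c) = 1`.
open Classical in
theorem crossFormula_braid (p q r : I) {a b c : K} (hab : a - b ≠ 0) (hac : a - c ≠ 0)
    (hbc : b - c ≠ 0) (g g₁ g₂ g₁₂ g₂₁ g₀ : K) :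
    crossFormula o q r a b
        (crossFormula o p r b c (crossFormula o p q a b g g₁) (crossFormula o p q a c g₂ g₂₁))
        (crossFormula o p r a c (crossFormula o p q b a g₁ g) (crossFormula o p q b c g₁₂ g₀)) -
      crossFormula o p q b c
        (crossFormula o p r a b (crossFormula o q r b c g g₂) (crossFormula o q r a c g₁ g₁₂))
        (crossFormula o p r a c (crossFormula o q r c b g₂ g) (crossFormula o q r a b g₂₁ g₀)) =
      if p = r ∧ Γ.Adj p q then g else 0 := by
  have hba : b - a ≠ 0 := by rwa [← neg_sub, neg_ne_zero]
  have hcb : c - b ≠ 0 := by rwa [← neg_sub, neg_ne_zero]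
  by_cases hpq : p = q
  · subst hpq
    simp only [Γ.irrefl, and_false, if_false]
    by_cases hpr : p = r
    · subst hpr
      simp only [crossFormula_self]
      field_simp
      ring
    · simp only [crossFormula_self, crossFormula_ne o hpr]
      ring
  by_cases hqr : q = r
  · subst hqr
    simp only [hpq, false_and, if_false, crossFormula_self, crossFormula_ne o hpq]
    ring
  by_cases hpr : p = r
  · subst hpr
    simp only [true_and, crossFormula_self, crossFormula_ne o hpq, crossFormula_ne o hqr]
    rw [edgeFactor_comm o p q b a, edgeFactor_comm o q p c b]
    by_cases h : Γ.Adj p q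
    · rw [if_pos h]
      rcases (o.adj_iff p q).1 h with h | h
      · simp only [edgeFactor, h, o.asymm _ _ h, if_true, if_false]
        field_simp
        ring
      · simp only [edgeFactor, h, o.asymm _ _ h, if_true, if_false]
        field_simp
        ring
    · rw [if_neg h]
      simp only [edgeFactor_of_not_adj o h, edgeFactor_of_not_adj o (mt Γ.adj_symm h)]
      ring
  · simp only [hpr, false_and, if_false, crossFormula_ne o hpr, crossFormula_ne o hpq,
      crossFormula_ne o hqr]
    ring

end CrossFormula

end KL

namespace KL

universe u

open MvPolynomial

variable {I : Type u} {Γ : SimpleGraph I} {ν : I →₀ ℕ}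

/-! ### Simple transpositions acting on sequences -/

section SeqSwap

theorem simpleTr_lpos {m : ℕ} (k : Fin (m - 1)) : simpleTr k (lpos k) = rpos k :=
  Equiv.swap_apply_left _ _

theorem simpleTr_rpos {m : ℕ} (k : Fin (m - 1)) : simpleTr k (rpos k) = lpos k :=
  Equiv.swap_apply_right _ _

theorem simpleTr_of_ne {m : ℕ} {k : Fin (m - 1)} {a : Fin m} (hl : a ≠ lpos k) (hr : a ≠ rpos k) :
    simpleTr k a = a :=
  Equiv.swap_apply_of_ne_of_ne hl hr

theorem Seq.swap_vertex (k : Fin (len ν - 1)) (i : Seq ν) (a : Fin (len ν)) :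
    (i.swap k).vertex a = i.vertex (simpleTr k a) := rfl

theorem Seq.swap_swap (k : Fin (len ν - 1)) (i : Seq ν) : (i.swap k).swap k = i := by
  change i.perm (simpleTr k * simpleTr k) = i
  rw [simpleTr_mul_self, Seq.perm_one]

theorem Seq.swap_comm {k l : Fin (len ν - 1)} (h : k.1 + 1 < l.1) (i : Seq ν) :
    (i.swap l).swap k = (i.swap k).swap l := by
  change i.perm (simpleTr k * simpleTr l) = i.perm (simpleTr l * simpleTr k)
  rw [simpleTr_commute h]

theorem Seq.swap_braid {k l : Fin (len ν - 1)} (h : l.1 = k.1 + 1) (i : Seq ν) :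
    ((i.swap k).swap l).swap k = ((i.swap l).swap k).swap l := by
  change i.perm (simpleTr k * (simpleTr l * simpleTr k)) =
    i.perm (simpleTr l * (simpleTr k * simpleTr l))
  rw [simpleTr_braid h]

theorem Seq.swap_of_eq {k : Fin (len ν - 1)} {i : Seq ν}
    (h : i.vertex (lpos k) = i.vertex (rpos k)) : i.swap k = i := by
  ext a
  rw [Seq.swap_vertex, simpleTr, Equiv.swap_apply_def]
  split_ifs with h1 h2
  · rw [h1, h]
  · rw [h2, h]
  · rfl

end SeqSwap

/-! ### Crossing operators on polynomials -/

section CrossOp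

variable (o : Orientation Γ)

open Classical in
/-- The action of the crossing `δ_{k,i}` on polynomials. -/
noncomputable def crossOp (k : Fin (len ν - 1)) (i : Seq ν) :
    Module.End ℤ (MvPolynomial (Fin (len ν)) ℤ) :=
  if i.vertex (lpos k) = i.vertex (rpos k) then divDiff k
  else if o.arrow (i.vertex (lpos k)) (i.vertex (rpos k)) then
    (LinearMap.mulLeft ℤ (X (lpos k) + X (rpos k))).comp (rename (simpleTr k)).toLinearMap
  else (rename (simpleTr k)).toLinearMap

/-- In the field the divided difference is a genuine quotient. All relations between operators are
transported there and reduced to the formulas for `crossFormula`. -/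
theorem toRat_crossOp (k : Fin (len ν - 1)) (i : Seq ν) (f : MvPolynomial (Fin (len ν)) ℤ) :
    toRat _ (crossOp o k i f) =
      crossFormula o (i.vertex (lpos k)) (i.vertex (rpos k)) (ratX (lpos k)) (ratX (rpos k))
        (toRat _ f) (ratPerm (simpleTr k) (toRat _ f)) := by
  unfold crossOp crossFormula edgeFactor
  rw [ratPerm_toRat]
  split_ifs with h1 h2
  · rw [eq_div_iff (ratX_sub_ne_zero (lpos_ne_rpos k)), ratX, ratX, ← map_sub, ← map_sub, ← map_mul,
      mul_comm, mul_divDiff]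
    rfl
  · simp [ratX]
  · simp

theorem crossOp_crossOp (k : Fin (len ν - 1)) (i : Seq ν) (f : MvPolynomial (Fin (len ν)) ℤ) :
    toRat _ (crossOp o k (i.swap k) (crossOp o k i f)) =
      crossFormula o (i.vertex (rpos k)) (i.vertex (lpos k)) (ratX (lpos k)) (ratX (rpos k))
        (crossFormula o (i.vertex (lpos k)) (i.vertex (rpos k)) (ratX (lpos k)) (ratX (rpos k))
          (toRat _ f) (ratPerm (simpleTr k) (toRat _ f)))
        (crossFormula o (i.vertex (lpos k)) (i.vertex (rpos k)) (ratX (rpos k)) (ratX (lpos k))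
          (ratPerm (simpleTr k) (toRat _ f)) (toRat _ f)) := by
  simp only [toRat_crossOp, map_crossFormula, ratPerm_ratX, Seq.swap_vertex, simpleTr_lpos,
    simpleTr_rpos, ratPerm_ratPerm, simpleTr_mul_self, ratPerm_one]

theorem crossFormula_crossFormula {K : Type*} [Field K] {p q : I} {a b g g' : K} (h : p ≠ q) :
    crossFormula o q p a b (crossFormula o p q a b g g') (crossFormula o p q b a g' g) =
      edgeFactor o p q a b * edgeFactor o q p a b * g := by
  rw [crossFormula_ne o h, crossFormula_ne o h, crossFormula_ne o h.symm, edgeFactor_comm o p q b a]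
  ring

theorem crossOp_sq_eq {k : Fin (len ν - 1)} {i : Seq ν}
    (h : i.vertex (lpos k) = i.vertex (rpos k)) : crossOp o k (i.swap k) * crossOp o k i = 0 := by
  refine LinearMap.ext fun f => toRat_injective ?_
  rw [Module.End.mul_apply, crossOp_crossOp, h]
  simp only [crossFormula_self, LinearMap.zero_apply, map_zero]
  have h1 := ratX_sub_ne_zero (lpos_ne_rpos k)
  have h2 := ratX_sub_ne_zero (lpos_ne_rpos k).symm
  field_simp
  ring

theorem crossOp_sq_far {k : Fin (len ν - 1)} {i : Seq ν}
    (hne : i.vertex (lpos k) ≠ i.vertex (rpos k))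
    (h : ¬ Γ.Adj (i.vertex (lpos k)) (i.vertex (rpos k))) :
    crossOp o k (i.swap k) * crossOp o k i = 1 := by
  refine LinearMap.ext fun f => toRat_injective ?_
  rw [Module.End.mul_apply, crossOp_crossOp,
    crossFormula_crossFormula o hne,
    edgeFactor_of_not_adj o h, edgeFactor_of_not_adj o (mt Γ.adj_symm h)]
  simp

theorem crossOp_sq_adj {k : Fin (len ν - 1)} {i : Seq ν}
    (h : Γ.Adj (i.vertex (lpos k)) (i.vertex (rpos k))) :
    crossOp o k (i.swap k) * crossOp o k i =
      LinearMap.mulLeft ℤ (X (lpos k)) + LinearMap.mulLeft ℤ (X (rpos k)) := by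
  refine LinearMap.ext fun f => toRat_injective ?_
  rw [Module.End.mul_apply, crossOp_crossOp,
    crossFormula_crossFormula o h.ne,
    edgeFactor_mul_of_adj o h]
  simp [ratX, add_mul]

theorem crossOp_mul_X {k : Fin (len ν - 1)} {l : Fin (len ν)} (i : Seq ν) (hl : l ≠ lpos k)
    (hr : l ≠ rpos k) :
    crossOp o k i * LinearMap.mulLeft ℤ (X l) = LinearMap.mulLeft ℤ (X l) * crossOp o k i := by
  refine LinearMap.ext fun f => toRat_injective ?_
  simp only [Module.End.mul_apply, LinearMap.mulLeft_apply, map_mul, toRat_crossOp]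
  change crossFormula o _ _ _ _ (ratX l * _) (ratPerm _ (ratX l) * _) = ratX l * _
  rw [ratPerm_ratX, simpleTr_of_ne hl hr]
  unfold crossFormula
  split_ifs <;> ring

theorem X_mul_crossOp_of_ne {k : Fin (len ν - 1)} {i : Seq ν}
    (h : i.vertex (lpos k) ≠ i.vertex (rpos k)) (a : Fin (len ν)) :
    LinearMap.mulLeft ℤ (X (simpleTr k a)) * crossOp o k i =
      crossOp o k i * LinearMap.mulLeft ℤ (X a) := by
  refine LinearMap.ext fun f => toRat_injective ?_
  simp only [Module.End.mul_apply, LinearMap.mulLeft_apply, map_mul, toRat_crossOp,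
    crossFormula_ne o h]
  change ratX _ * _ = _ * (ratPerm _ (ratX a) * _)
  rw [ratPerm_ratX]
  ring

theorem X_lpos_mul_crossOp_of_eq {k : Fin (len ν - 1)} {i : Seq ν}
    (h : i.vertex (lpos k) = i.vertex (rpos k)) :
    LinearMap.mulLeft ℤ (X (lpos k)) * crossOp o k i -
      crossOp o k i * LinearMap.mulLeft ℤ (X (rpos k)) = 1 := by
  refine LinearMap.ext fun f => toRat_injective ?_
  simp only [Module.End.mul_apply, LinearMap.mulLeft_apply, map_mul, toRat_crossOp, h,
    crossFormula_self, LinearMap.sub_apply, map_sub, Module.End.one_apply]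
  change ratX _ * _ - (ratX _ * _ - ratPerm _ (ratX _) * _) / _ = _
  rw [ratPerm_ratX, simpleTr_rpos]
  have h1 := ratX_sub_ne_zero (lpos_ne_rpos k)
  field_simp
  ring

theorem crossOp_mul_X_lpos_of_eq {k : Fin (len ν - 1)} {i : Seq ν}
    (h : i.vertex (lpos k) = i.vertex (rpos k)) :
    crossOp o k i * LinearMap.mulLeft ℤ (X (lpos k)) -
      LinearMap.mulLeft ℤ (X (rpos k)) * crossOp o k i = 1 := by
  refine LinearMap.ext fun f => toRat_injective ?_
  simp only [Module.End.mul_apply, LinearMap.mulLeft_apply, map_mul, toRat_crossOp, h,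
    crossFormula_self, LinearMap.sub_apply, map_sub, Module.End.one_apply]
  change (ratX _ * _ - ratPerm _ (ratX _) * _) / _ - ratX _ * _ = _
  rw [ratPerm_ratX, simpleTr_lpos]
  have h1 := ratX_sub_ne_zero (lpos_ne_rpos k)
  field_simp
  ring

theorem crossOp_comm {k l : Fin (len ν - 1)} (h : k.1 + 1 < l.1) (i : Seq ν) :
    crossOp o k (i.swap l) * crossOp o l i = crossOp o l (i.swap k) * crossOp o k i := by
  have h1 : simpleTr k (lpos l) = lpos l := simpleTr_of_ne
    (by simp [lpos, Fin.ext_iff]; omega) (by simp [lpos, rpos, Fin.ext_iff]; omega)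
  have h2 : simpleTr k (rpos l) = rpos l := simpleTr_of_ne
    (by simp [lpos, rpos, Fin.ext_iff]; omega) (by simp [rpos, Fin.ext_iff]; omega)
  have h3 : simpleTr l (lpos k) = lpos k := simpleTr_of_ne
    (by simp [lpos, Fin.ext_iff]; omega) (by simp [lpos, rpos, Fin.ext_iff]; omega)
  have h4 : simpleTr l (rpos k) = rpos k := simpleTr_of_ne
    (by simp [lpos, rpos, Fin.ext_iff]; omega) (by simp [rpos, Fin.ext_iff]; omega)
  refine LinearMap.ext fun f => toRat_injective ?_
  simp only [Module.End.mul_apply, toRat_crossOp, map_crossFormula, ratPerm_ratX, Seq.swap_vertex,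
    ratPerm_ratPerm, h1, h2, h3, h4, simpleTr_commute h]
  exact crossFormula_comm o ..

open Classical in
theorem crossOp_braid {k l : Fin (len ν - 1)} (h : l.1 = k.1 + 1) (i : Seq ν) :
    crossOp o k ((i.swap k).swap l) * crossOp o l (i.swap k) * crossOp o k i -
        crossOp o l ((i.swap l).swap k) * crossOp o k (i.swap l) * crossOp o l i =
      if i.vertex (lpos k) = i.vertex (rpos l) ∧ Γ.Adj (i.vertex (lpos k)) (i.vertex (rpos k))
      then 1 else 0 := by
  have hl : lpos l = rpos k := Fin.ext h
  have hkc : rpos l ≠ lpos k := by simp [lpos, rpos, Fin.ext_iff]; omega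
  have hkd : rpos l ≠ rpos k := by simp [rpos, Fin.ext_iff]; omega
  have h1 : simpleTr k (rpos l) = rpos l := simpleTr_of_ne hkc hkd
  have h2 : simpleTr l (lpos k) = lpos k := simpleTr_of_ne (hl ▸ lpos_ne_rpos k) hkc.symm
  have h3 : simpleTr l (rpos k) = rpos l := hl ▸ simpleTr_lpos l
  have h4 : simpleTr l (rpos l) = rpos k := hl ▸ simpleTr_rpos l
  refine LinearMap.ext fun f => toRat_injective ?_
  have key := crossFormula_braid o (i.vertex (lpos k)) (i.vertex (rpos k)) (i.vertex (rpos l))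
    (ratX_sub_ne_zero (lpos_ne_rpos k)) (ratX_sub_ne_zero hkc.symm) (ratX_sub_ne_zero hkd.symm)
    (toRat _ f) (ratPerm (simpleTr k) (toRat _ f)) (ratPerm (simpleTr l) (toRat _ f))
    (ratPerm (simpleTr k * simpleTr l) (toRat _ f)) (ratPerm (simpleTr l * simpleTr k) (toRat _ f))
    (ratPerm (simpleTr k * (simpleTr l * simpleTr k)) (toRat _ f))
  simp only [LinearMap.sub_apply, Module.End.mul_apply, map_sub, toRat_crossOp, map_crossFormula,
    ratPerm_ratX, Seq.swap_vertex, ratPerm_ratPerm, simpleTr_lpos, simpleTr_rpos, hl, h1, h2, h3, h4,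
    simpleTr_mul_self, ratPerm_one, mul_assoc, ← simpleTr_braid h]
  refine key.trans ?_
  split_ifs <;> simp

end CrossOp

/-! ### The polynomial representation and its uniqueness -/

section Action

/-- The operator on `Pol_ν` that takes `Pol_i` to `Pol_j` by `T`. -/
noncomputable def matrixOp (j i : Seq ν) (T : Module.End ℤ (MvPolynomial (Fin (len ν)) ℤ)) :
    Module.End ℤ (Pol ν) :=
  (Finsupp.lsingle j).comp (T.comp (Finsupp.lapply i))

theorem matrixOp_single (j i : Seq ν) (T : Module.End ℤ (MvPolynomial (Fin (len ν)) ℤ))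
    (f : MvPolynomial (Fin (len ν)) ℤ) :
    matrixOp j i T (Finsupp.single i f) = Finsupp.single j (T f) := by
  simp [matrixOp]

theorem matrixOp_single_ne (j : Seq ν) {i i' : Seq ν} (h : i' ≠ i)
    (T : Module.End ℤ (MvPolynomial (Fin (len ν)) ℤ)) (f : MvPolynomial (Fin (len ν)) ℤ) :
    matrixOp j i T (Finsupp.single i' f) = 0 := by
  simp [matrixOp, Finsupp.single_eq_of_ne h.symm]

theorem matrixOp_mul (k j i : Seq ν) (S T : Module.End ℤ (MvPolynomial (Fin (len ν)) ℤ)) :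
    matrixOp k j S * matrixOp j i T = matrixOp k i (S * T) := by
  refine LinearMap.ext fun f => ?_
  simp [matrixOp]

theorem matrixOp_mul_ne (k i : Seq ν) {j j' : Seq ν} (h : j' ≠ j)
    (S T : Module.End ℤ (MvPolynomial (Fin (len ν)) ℤ)) :
    matrixOp k j' S * matrixOp j i T = 0 := by
  refine LinearMap.ext fun f => ?_
  simp [matrixOp, Finsupp.single_eq_of_ne h]

theorem matrixOp_add (j i : Seq ν) (S T : Module.End ℤ (MvPolynomial (Fin (len ν)) ℤ)) :
    matrixOp j i (S + T) = matrixOp j i S + matrixOp j i T := by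
  simp [matrixOp, LinearMap.add_comp, LinearMap.comp_add]

theorem matrixOp_sub (j i : Seq ν) (S T : Module.End ℤ (MvPolynomial (Fin (len ν)) ℤ)) :
    matrixOp j i (S - T) = matrixOp j i S - matrixOp j i T := by
  simp [matrixOp, LinearMap.sub_comp, LinearMap.comp_sub]

theorem matrixOp_zero (j i : Seq ν) : matrixOp j i 0 = 0 := by
  simp [matrixOp]

theorem sum_matrixOp : ∑ i : Seq ν, matrixOp i i 1 = 1 := by
  refine Finsupp.lhom_ext fun i f => ?_
  rw [LinearMap.sum_apply, Finset.sum_eq_single i, matrixOp_single]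
  · rfl
  · exact fun j _ h => matrixOp_single_ne j h.symm 1 f
  · simp

variable (o : Orientation Γ)

/-- The action of the elementary diagrams on `Pol_ν`. -/
noncomputable def genOp : Gen ν → Module.End ℤ (Pol ν)
  | .idem i => matrixOp i i 1
  | .dot k i => matrixOp i i (LinearMap.mulLeft ℤ (X k))
  | .cross k i => matrixOp (i.swap k) i (crossOp o k i)

/-- Every generator acts as one block of a matrix indexed by sequences. A relation thus splits into
agreement of the sequences at the two ends and an identity between operators on polynomials. -/
theorem lift_genOp_rel {a b : FreeAlgebra ℤ (Gen ν)} (h : Rel Γ ν a b) :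
    FreeAlgebra.lift ℤ (genOp o) a = FreeAlgebra.lift ℤ (genOp o) b := by
  have hx : ∀ k l : Fin (len ν), (LinearMap.mulLeft ℤ (X k) * LinearMap.mulLeft ℤ (X l) :
      Module.End ℤ (MvPolynomial (Fin (len ν)) ℤ)) =
      LinearMap.mulLeft ℤ (X l) * LinearMap.mulLeft ℤ (X k) := fun k l =>
    LinearMap.ext fun f => by simp [mul_left_comm]
  induction h with
  | idem_mul_self i => simp [fe, genOp, matrixOp_mul]
  | idem_mul_ne i j h => simp [fe, genOp, matrixOp_mul_ne _ _ h]
  | sum_idem => simp [fe, genOp, sum_matrixOp]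
  | dot_bot k i => simp [fe, fx, genOp, matrixOp_mul]
  | dot_top k i => simp [fe, fx, genOp, matrixOp_mul]
  | cross_bot k i => simp [fe, fd, genOp, matrixOp_mul]
  | cross_top k i => simp [fe, fd, genOp, matrixOp_mul]
  | dot_dot k l i => simp [fx, genOp, matrixOp_mul, hx k l]
  | cross_dot k l i hl hr => simp [fx, fd, genOp, matrixOp_mul, crossOp_mul_X o i hl hr]
  | cross_cross k l i h =>
    simp [fd, genOp, matrixOp_mul, crossOp_comm o h i, Seq.swap_comm h i]
  | double_eq k i h => simp [fd, genOp, matrixOp_mul, crossOp_sq_eq o h, matrixOp_zero]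
  | double_far k i hne h =>
    simp [fe, fd, genOp, matrixOp_mul, crossOp_sq_far o hne h, Seq.swap_swap]
  | double_adj k i h =>
    simp [fx, fd, genOp, matrixOp_mul, crossOp_sq_adj o h, Seq.swap_swap, matrixOp_add]
  | slide_ne_left k i h =>
    have := X_mul_crossOp_of_ne o h (rpos k)
    rw [simpleTr_rpos] at this
    simp [fx, fd, genOp, matrixOp_mul, this]
  | slide_ne_right k i h =>
    have := X_mul_crossOp_of_ne o h (lpos k)
    rw [simpleTr_lpos] at this
    simp [fx, fd, genOp, matrixOp_mul, this]
  | slide_eq_left k i h =>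
    simp [fe, fx, fd, genOp, matrixOp_mul, Seq.swap_of_eq h, ← matrixOp_sub,
      X_lpos_mul_crossOp_of_eq o h]
  | slide_eq_right k i h =>
    simp [fe, fx, fd, genOp, matrixOp_mul, Seq.swap_of_eq h, ← matrixOp_sub,
      crossOp_mul_X_lpos_of_eq o h]
  | braid_easy k l hkl i h =>
    have := crossOp_braid o hkl i
    rw [if_neg h, sub_eq_zero] at this
    simp [fd, genOp, matrixOp_mul, this, Seq.swap_braid hkl]
  | braid_hard k l hkl i h hadj =>
    have := crossOp_braid o hkl i
    rw [if_pos ⟨h, hadj⟩] at this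
    -- The error term `1_i` ends at `i`, so the triple crossing must too. The labels are `p q p`;
    -- the first swap gives `p p q`, the second changes nothing, the third restores `p q p`.
    have hi : ((i.swap l).swap k).swap l = i := by
      have hl : lpos l = rpos k := Fin.ext hkl
      have : (i.swap l).swap k = i.swap l := Seq.swap_of_eq (by
        have h1 : lpos k ≠ lpos l := by rw [hl]; exact lpos_ne_rpos k
        have h2 : lpos k ≠ rpos l := by simp [lpos, rpos, Fin.ext_iff]; omega
        rw [Seq.swap_vertex, Seq.swap_vertex, ← hl, simpleTr_lpos, simpleTr_of_ne h1 h2, h])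
      rw [this, Seq.swap_swap]
    simp [fe, fd, genOp, matrixOp_mul, Seq.swap_braid hkl, ← matrixOp_sub, this, hi]

/-- The action of `R(ν)` on `Pol_ν`. -/
noncomputable def polAction : R Γ ν →+* Module.End ℤ (Pol ν) :=
  RingQuot.lift ⟨(FreeAlgebra.lift ℤ (genOp o)).toRingHom, fun _ _ h => lift_genOp_rel o h⟩

theorem polAction_mk (a : FreeAlgebra ℤ (Gen ν)) :
    polAction o (mk Γ ν a) = FreeAlgebra.lift ℤ (genOp o) a :=
  RingQuot.lift_mkRingHom_apply ..

theorem polAction_e (i : Seq ν) : polAction o (e Γ i) = matrixOp i i 1 := by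
  simp [e, polAction_mk, fe, genOp]

theorem polAction_x (k : Fin (len ν)) (i : Seq ν) :
    polAction o (x Γ k i) = matrixOp i i (LinearMap.mulLeft ℤ (X k)) := by
  simp [x, polAction_mk, fx, genOp]

theorem polAction_δ (k : Fin (len ν - 1)) (i : Seq ν) :
    polAction o (δ Γ k i) = matrixOp (i.swap k) i (crossOp o k i) := by
  simp [δ, polAction_mk, fd, genOp]

theorem crossOp_of_eq {k : Fin (len ν - 1)} {i : Seq ν}
    (h : i.vertex (lpos k) = i.vertex (rpos k)) (f : MvPolynomial (Fin (len ν)) ℤ) :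
    (X (lpos k) - X (rpos k)) * crossOp o k i f = f - sPol k f := by
  rw [crossOp, if_pos h, mul_divDiff]

theorem crossOp_of_not_arrow {k : Fin (len ν - 1)} {i : Seq ν}
    (h : i.vertex (lpos k) ≠ i.vertex (rpos k))
    (h' : ¬ o.arrow (i.vertex (lpos k)) (i.vertex (rpos k))) (f : MvPolynomial (Fin (len ν)) ℤ) :
    crossOp o k i f = sPol k f := by
  rw [crossOp, if_neg h, if_neg h']
  rfl

theorem crossOp_of_arrow {k : Fin (len ν - 1)} {i : Seq ν}
    (h : o.arrow (i.vertex (lpos k)) (i.vertex (rpos k))) (f : MvPolynomial (Fin (len ν)) ℤ) :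
    crossOp o k i f = (X (lpos k) + X (rpos k)) * sPol k f := by
  rw [crossOp, if_neg (fun h' => o.not_arrow_self _ (h' ▸ h)), if_pos h]
  rfl

theorem isPolAction_polAction : IsPolAction o (polAction (ν := ν) o) where
  idem_self i f := by rw [polAction_e, matrixOp_single]; rfl
  idem_ne i j f h := by rw [polAction_e, matrixOp_single_ne _ h]
  dot k i f := by rw [polAction_x, matrixOp_single]; rfl
  cross_far k i f h h' := by
    rw [polAction_δ, matrixOp_single,
      crossOp_of_not_arrow o h fun h => h' ((o.adj_iff _ _).2 (.inl h))]
  cross_eq k i f h := ⟨crossOp o k i f, crossOp_of_eq o h f, by rw [polAction_δ, matrixOp_single]⟩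
  cross_left k i f h := by
    rw [polAction_δ, matrixOp_single, crossOp_of_not_arrow o _ (o.asymm _ _ h)]
    exact fun h' => o.not_arrow_self _ (h' ▸ h)
  cross_right k i f h := by rw [polAction_δ, matrixOp_single, crossOp_of_arrow o h]

variable {o}

/-- Since `r = r 1_i`, the element kills every summand other than `Pol_i`, so its values on `Pol_i`
determine it. -/
theorem IsPolAction.eq_matrixOp {ρ : R Γ ν →+* Module.End ℤ (Pol ν)} (hρ : IsPolAction o ρ)
    {r : R Γ ν} {i j : Seq ν} (hr : r * e Γ i = r)
    {T : Module.End ℤ (MvPolynomial (Fin (len ν)) ℤ)}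
    (h : ∀ f, ρ r (Finsupp.single i f) = Finsupp.single j (T f)) : ρ r = matrixOp j i T := by
  refine Finsupp.lhom_ext fun i' f => ?_
  by_cases hi : i' = i
  · subst hi
    rw [h, matrixOp_single]
  · rw [← hr, map_mul, Module.End.mul_apply, hρ.idem_ne _ _ _ hi, map_zero, matrixOp_single_ne _ hi]

theorem IsPolAction.eq_polAction {ρ : R Γ ν →+* Module.End ℤ (Pol ν)} (hρ : IsPolAction o ρ) :
    ρ = polAction o := by
  refine RingHom.ext fun r => ?_
  induction r using R.induction with
  | int n => simp
  | he i => rw [polAction_e]; exact hρ.eq_matrixOp (e_mul_self i) (hρ.idem_self i)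
  | hx k i => rw [polAction_x]; exact hρ.eq_matrixOp (x_mul_e k i) (hρ.dot k i)
  | hδ k i =>
    rw [polAction_δ]
    refine hρ.eq_matrixOp (δ_mul_e k i) fun f => ?_
    by_cases h : i.vertex (lpos k) = i.vertex (rpos k)
    -- The quotient `g` is only asserted to exist, but cancelling `x_k - x_{k+1}` shows that it is
    -- unique.
    · obtain ⟨g, hg, hg'⟩ := hρ.cross_eq k i f h
      rw [← crossOp_of_eq o h f] at hg
      rw [hg', mul_left_cancel₀ (X_sub_X_ne_zero (lpos_ne_rpos k)) hg]
    by_cases h1 : o.arrow (i.vertex (lpos k)) (i.vertex (rpos k))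
    · rw [hρ.cross_right k i f h1, crossOp_of_arrow o h1]
    rw [crossOp_of_not_arrow o h h1]
    by_cases h2 : o.arrow (i.vertex (rpos k)) (i.vertex (lpos k))
    · exact hρ.cross_left k i f h2
    · exact hρ.cross_far k i f h fun h' => ((o.adj_iff _ _).1 h').elim h1 h2
  | add r s hr hs => rw [map_add, map_add, hr, hs]
  | mul r s hr hs => rw [map_mul, map_mul, hr, hs]

end Action

end KL

namespace KL

universe u

open MvPolynomial

variable {I : Type u} {Γ : SimpleGraph I} {ν : I →₀ ℕ}

/-! ### Linear independence by triangularity -/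

section Independence

variable {m : ℕ}

/-- The permutation `w` of the variables, as a function from polynomials to rational functions. -/
noncomputable def permFun (w : Equiv.Perm (Fin m)) : MvPolynomial (Fin m) ℤ → RatField m :=
  fun f => ratPerm w (toRat m f)

/-- Dedekind's independence of characters: distinct permutations are distinct multiplicative maps
into a field, being separated by the variables. -/
theorem linearIndependent_permFun :
    LinearIndependent (RatField m) (permFun (m := m)) := by
  let V : Equiv.Perm (Fin m) → MvPolynomial (Fin m) ℤ →* RatField m :=
    fun w => ((ratPerm w).comp (toRat m) : MvPolynomial (Fin m) ℤ →+* RatField m)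
  have hV : Function.Injective V := fun v w h => by
    ext a
    have h1 : ratPerm v (ratX a) = ratPerm w (ratX a) := DFunLike.congr_fun h (X a)
    rw [ratPerm_ratX, ratPerm_ratX] at h1
    rw [X_injective (toRat_injective h1)]
  exact (linearIndependent_monoidHom (MvPolynomial (Fin m) ℤ) (RatField m)).comp V hV

/-- The combinations of the permutations of the variables which are products of fewer than `n`
simple transpositions. -/
noncomputable def shortSpan (m n : ℕ) :
    Submodule (RatField m) (MvPolynomial (Fin m) ℤ → RatField m) :=
  Submodule.span _ {g | ∃ l : List (Fin (m - 1)), l.length < n ∧ g = permFun (wordProd l)}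

theorem shortSpan_mono {n n' : ℕ} (h : n ≤ n') : shortSpan m n ≤ shortSpan m n' :=
  Submodule.span_mono fun _ ⟨l, hl, hg⟩ => ⟨l, hl.trans_le h, hg⟩

theorem permFun_mem_shortSpan {n : ℕ} {l : List (Fin (m - 1))} (h : l.length < n) :
    permFun (wordProd l) ∈ shortSpan m n :=
  Submodule.subset_span ⟨l, h, rfl⟩

/-- Applying `s_k` is only semilinear, but the moved coefficients stay in the field, so the words
just get one letter longer. -/
theorem ratPerm_comp_mem_shortSpan (k : Fin (m - 1)) {n : ℕ}
    {g : MvPolynomial (Fin m) ℤ → RatField m} (hg : g ∈ shortSpan m n) :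
    (fun f => ratPerm (simpleTr k) (g f)) ∈ shortSpan m (n + 1) := by
  induction hg using Submodule.span_induction with
  | mem g hg =>
    obtain ⟨l, hl, rfl⟩ := hg
    refine Submodule.subset_span ⟨k :: l, by simpa using hl, ?_⟩
    ext1 f
    rw [permFun, permFun, ratPerm_ratPerm, wordProd_cons]
  | zero => simp only [Pi.zero_apply, map_zero]; exact zero_mem _
  | add g h _ _ hg hh => simp only [Pi.add_apply, map_add]; exact add_mem hg hh
  | smul c g _ hg =>
    simp only [Pi.smul_apply, smul_eq_mul, map_mul]
    exact Submodule.smul_mem _ _ hg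

/-- Permutations are multiplicative, so `c` comes out of each one as a scalar. -/
theorem mul_mem_shortSpan (c : MvPolynomial (Fin m) ℤ) {n : ℕ}
    {g : MvPolynomial (Fin m) ℤ → RatField m} (hg : g ∈ shortSpan m n) :
    (fun f => g (c * f)) ∈ shortSpan m n := by
  induction hg using Submodule.span_induction with
  | mem g hg =>
    obtain ⟨l, hl, rfl⟩ := hg
    simp only [permFun, map_mul]
    exact Submodule.smul_mem _ (ratPerm (wordProd l) (toRat m c)) (permFun_mem_shortSpan hl)
  | zero => exact zero_mem _
  | add g h _ _ hg hh => exact add_mem hg hh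
  | smul c g _ hg => exact Submodule.smul_mem _ _ hg

/-- A word shorter than a reduced word of `w` cannot represent `w`. -/
theorem shortSpan_le {l : List (Fin (m - 1))} {w : Equiv.Perm (Fin m)}
    (hl : IsMinimalPresentation l w) :
    shortSpan m l.length ≤ Submodule.span (RatField m) (permFun '' {w}ᶜ) := by
  refine Submodule.span_mono ?_
  rintro _ ⟨l', hl', rfl⟩
  exact ⟨_, fun h => absurd hl' (not_lt.2 (hl.2 l' h)), rfl⟩

theorem ratX_add_ne_zero (a b : Fin m) : ratX a + ratX b ≠ 0 := by
  rw [ratX, ratX, ← map_add, map_ne_zero_iff _ toRat_injective]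
  intro h
  simpa using congrArg (MvPolynomial.eval fun _ => (1 : ℤ)) h

variable (o : Orientation Γ)

/-- The leading coefficient `A` is `-1 / (x_k - x_{k+1})` for equal labels, and `1` or `x_k +
x_{k+1}` otherwise; its not vanishing makes the action triangular. -/
theorem exists_toRat_crossOp (k : Fin (len ν - 1)) (i : Seq ν) :
    ∃ A B : RatField (len ν), A ≠ 0 ∧ ∀ f, toRat _ (crossOp o k i f) =
      A * ratPerm (simpleTr k) (toRat _ f) + B * toRat _ f := by
  simp only [toRat_crossOp]
  by_cases h : i.vertex (lpos k) = i.vertex (rpos k)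
  · have h1 := ratX_sub_ne_zero (lpos_ne_rpos k)
    refine ⟨-(ratX (lpos k) - ratX (rpos k))⁻¹, (ratX (lpos k) - ratX (rpos k))⁻¹,
      neg_ne_zero.2 (inv_ne_zero h1), fun f => ?_⟩
    rw [h, crossFormula_self]
    ring
  · refine ⟨edgeFactor o (i.vertex (lpos k)) (i.vertex (rpos k)) (ratX (lpos k)) (ratX (rpos k)), 0,
      edgeFactor_ne_zero o (ratX_add_ne_zero (lpos k) (rpos k)), fun f => ?_⟩
    rw [crossFormula_ne o h, zero_mul, add_zero]

/-- The action on polynomials of the diagram given by a word. -/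
noncomputable def wordOp (i : Seq ν) :
    List (Fin (len ν - 1)) → Module.End ℤ (MvPolynomial (Fin (len ν)) ℤ)
  | [] => 1
  | k :: l => crossOp o k (i.act l) * wordOp i l

theorem polAction_hat (l : List (Fin (len ν - 1))) (i : Seq ν) :
    polAction o (hat Γ l i) = matrixOp (i.act l) i (wordOp o i l) := by
  induction l with
  | nil => exact polAction_e o i
  | cons k l ih => rw [hat_cons, map_mul, ih, polAction_δ, matrixOp_mul]; rfl

theorem polAction_dotEval (i : Seq ν) (p f : MvPolynomial (Fin (len ν)) ℤ) :
    polAction o (dotEval Γ i p) (Finsupp.single i f) = Finsupp.single i (p * f) := by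
  induction p using MvPolynomial.induction_on generalizing f with
  | C a => simp [← MvPolynomial.C_mul']
  | add p q hp hq => rw [map_add, map_add, LinearMap.add_apply, hp, hq, add_mul, Finsupp.single_add]
  | mul_X p k hp =>
    rw [map_mul, map_mul, Module.End.mul_apply, dotEval_X, polAction_x, matrixOp_single, hp,
      LinearMap.mulLeft_apply, mul_assoc]

/-- The action of a word is triangular with respect to the permutations of the variables. -/
theorem exists_wordOp_sub_mem (i : Seq ν) (l : List (Fin (len ν - 1))) :
    ∃ a : RatField (len ν), a ≠ 0 ∧
      (fun f => toRat _ (wordOp o i l f)) - a • permFun (wordProd l) ∈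
        shortSpan (len ν) l.length := by
  induction l with
  | nil =>
    refine ⟨1, one_ne_zero, ?_⟩
    have : (fun f => toRat _ (wordOp o i [] f)) - (1 : RatField (len ν)) • permFun (wordProd []) =
        0 := by
      ext1 f
      simp [wordOp, permFun, wordProd, ratPerm_one]
    rw [this]
    exact zero_mem _
  | cons k l ih =>
    obtain ⟨a, ha, hu⟩ := ih
    obtain ⟨A, B, hA, hAB⟩ := exists_toRat_crossOp o k (i.act l)
    refine ⟨A * ratPerm (simpleTr k) a, mul_ne_zero hA ((map_ne_zero _).2 ha), ?_⟩
    set g := (fun f => toRat _ (wordOp o i l f)) - a • permFun (wordProd l) with hg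
    have : (fun f => toRat _ (wordOp o i (k :: l) f)) -
        (A * ratPerm (simpleTr k) a) • permFun (wordProd (k :: l)) =
        A • (fun f => ratPerm (simpleTr k) (g f)) + (B * a) • permFun (wordProd l) + B • g := by
      ext1 f
      simp only [hg, wordOp, Module.End.mul_apply, hAB, Pi.add_apply, Pi.sub_apply, Pi.smul_apply,
        smul_eq_mul, permFun, wordProd_cons, ← ratPerm_ratPerm, map_sub, map_mul]
      ring
    rw [this, List.length_cons]
    exact add_mem (add_mem (Submodule.smul_mem _ _ (ratPerm_comp_mem_shortSpan k hu))
      (Submodule.smul_mem _ _ (permFun_mem_shortSpan (Nat.lt_succ_self _))))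
      (Submodule.smul_mem _ _ (shortSpan_mono (Nat.le_succ _) hu))

variable (word : Equiv.Perm (Fin (len ν)) → List (Fin (len ν - 1)))

/-- Among the `w` with `c w ≠ 0` take one with the longest reduced word. Modulo the span `S` of all
other permutations the sum reduces to `w` with the nonzero coefficient `a w · w(c w)`, which
contradicts Dedekind's lemma. -/
theorem eq_zero_of_sum_wordOp (hword : ∀ w, IsMinimalPresentation (word w) w) (i : Seq ν)
    (c : Equiv.Perm (Fin (len ν)) → MvPolynomial (Fin (len ν)) ℤ)
    (h : ∀ f, ∑ w, wordOp o i (word w) (c w * f) = 0) : c = 0 := by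
  by_contra hc
  obtain ⟨w₀, hw₀⟩ := Function.ne_iff.1 hc
  obtain ⟨w, hw, hmax⟩ := Finset.exists_max_image (Finset.univ.filter fun w => c w ≠ 0)
    (fun w => (word w).length) ⟨w₀, by simpa using hw₀⟩
  simp only [Finset.mem_filter, Finset.mem_univ, true_and] at hw hmax
  choose a ha hu using fun v => exists_wordOp_sub_mem o i (word v)
  have hprod : ∀ v, wordProd (word v) = v := fun v => (hword v).1
  have term : ∀ v, (fun f => toRat _ (wordOp o i (word v) (c v * f))) -
      (a v * ratPerm v (toRat _ (c v))) • permFun v ∈ shortSpan (len ν) (word v).length := by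
    intro v
    convert mul_mem_shortSpan (c v) (hu v) using 1
    ext1 f
    simp only [Pi.sub_apply, Pi.smul_apply, smul_eq_mul, permFun, hprod, map_mul, mul_assoc]
  set S := Submodule.span (RatField (len ν)) (permFun '' {w}ᶜ : Set (_ → RatField (len ν)))
  have others : ∀ v, v ≠ w → (fun f => toRat _ (wordOp o i (word v) (c v * f))) ∈ S := by
    intro v hv
    by_cases hcv : c v = 0
    · have : (fun f => toRat _ (wordOp o i (word v) (c v * f))) = 0 := by
        ext1 f
        simp [hcv]
      rw [this]
      exact zero_mem S
    -- The lower terms of `v` come from words shorter than the reduced word of `w`, by the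
    -- maximality of `w`, and the leading term is `v ≠ w` itself.
    · have := add_mem (shortSpan_le (hword w) (shortSpan_mono (hmax v hcv) (term v)))
        (Submodule.smul_mem S (a v * ratPerm v (toRat _ (c v)))
          (Submodule.subset_span ⟨v, hv, rfl⟩))
      rwa [sub_add_cancel] at this
  have hsum : (fun f => toRat _ (wordOp o i (word w) (c w * f))) ∈ S := by
    have : (fun f => toRat _ (wordOp o i (word w) (c w * f))) =
        -∑ v ∈ Finset.univ.erase w, fun f => toRat _ (wordOp o i (word v) (c v * f)) := by
      ext1 f
      rw [Pi.neg_apply, eq_neg_iff_add_eq_zero, Finset.sum_apply, Finset.add_sum_erase _ (fun v =>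
        toRat _ (wordOp o i (word v) (c v * f))) (Finset.mem_univ w), ← map_sum, h, map_zero]
    rw [this]
    exact neg_mem (sum_mem fun v hv => others v (Finset.ne_of_mem_erase hv))
  have hmem : (a w * ratPerm w (toRat _ (c w))) • permFun w ∈ S := by
    have := sub_mem hsum (shortSpan_le (hword w) (term w))
    rwa [sub_sub_cancel] at this
  rw [Submodule.smul_mem_iff _ (mul_ne_zero (ha w)
    ((map_ne_zero _).2 ((map_ne_zero_iff _ toRat_injective).2 hw)))] at hmem
  exact linearIndependent_permFun.notMem_span_image (by simp) hmem

theorem eq_zero_of_polAction_eq_zero (hword : ∀ w, IsMinimalPresentation (word w) w) (i : Seq ν)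
    (c : Equiv.Perm (Fin (len ν)) → MvPolynomial (Fin (len ν)) ℤ)
    (h : polAction o (∑ w, hat Γ (word w) i * dotEval Γ i (c w)) = 0) : c = 0 := by
  refine eq_zero_of_sum_wordOp o word hword i c fun f => ?_
  -- Adding up all components forgets the top sequences, which may differ with `w`; the permutations
  -- are independent even so.
  have := congrArg (Finsupp.lsum ℤ fun _ : Seq ν =>
    (LinearMap.id : Module.End ℤ (MvPolynomial (Fin (len ν)) ℤ)))
    (LinearMap.congr_fun h (Finsupp.single i f))
  simpa only [map_sum, map_mul, LinearMap.sum_apply, Module.End.mul_apply, polAction_dotEval,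
    polAction_hat, matrixOp_single, LinearMap.zero_apply, map_zero, Finsupp.lsum_single,
    LinearMap.id_apply] using this

end Independence

/-- Every graph has an orientation. -/
theorem exists_orientation (Γ : SimpleGraph I) : Nonempty (Orientation Γ) := by
  classical
  -- Orient every edge upwards in some linear order of the vertices.
  let : LinearOrder I := linearOrderOfSTO WellOrderingRel
  exact ⟨{
    arrow := fun i j => Γ.Adj i j ∧ i < j
    adj_iff := fun i j => ⟨fun h => (lt_or_gt_of_ne h.ne).imp (⟨h, ·⟩) (⟨h.symm, ·⟩),
      fun h => h.elim And.left fun h => h.1.symm⟩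
    asymm := fun i j h h' => lt_asymm h.2 h'.2 }⟩

end KL

namespace KL

universe u

variable {I : Type u} (Γ : SimpleGraph I) {ν : I →₀ ℕ}

/-! ### The grading by degrees of diagrams -/

section Grading

theorem cartan_comm (p q : I) : cartan Γ p q = cartan Γ q p := by
  unfold cartan
  rw [Γ.adj_comm p q, eq_comm (a := p)]

theorem cartan_self (p : I) : cartan Γ p p = 2 := by simp [cartan]

variable {Γ}

theorem cartan_of_adj {p q : I} (h : Γ.Adj p q) : cartan Γ p q = -1 := by
  simp [cartan, h, h.ne]

theorem cartan_of_not_adj {p q : I} (hne : p ≠ q) (h : ¬ Γ.Adj p q) : cartan Γ p q = 0 := by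
  simp [cartan, h, hne]

variable (Γ)

/-- The degree of the crossing `δ_{k,i}`. -/
noncomputable def crossDeg (k : Fin (len ν - 1)) (i : Seq ν) : ℤ :=
  -cartan Γ (i.vertex (lpos k)) (i.vertex (rpos k))

theorem crossDeg_swap (k : Fin (len ν - 1)) (i : Seq ν) :
    crossDeg Γ k (i.swap k) = crossDeg Γ k i := by
  simp only [crossDeg, Seq.swap_vertex, simpleTr_lpos, simpleTr_rpos, cartan_comm]

theorem crossDeg_swap_of_lt {k l : Fin (len ν - 1)} (h : k.1 + 1 < l.1) (i : Seq ν) :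
    crossDeg Γ k (i.swap l) = crossDeg Γ k i ∧ crossDeg Γ l (i.swap k) = crossDeg Γ l i := by
  have h1 : simpleTr k (lpos l) = lpos l := simpleTr_of_ne
    (by simp [lpos, Fin.ext_iff]; omega) (by simp [lpos, rpos, Fin.ext_iff]; omega)
  have h2 : simpleTr k (rpos l) = rpos l := simpleTr_of_ne
    (by simp [lpos, rpos, Fin.ext_iff]; omega) (by simp [rpos, Fin.ext_iff]; omega)
  have h3 : simpleTr l (lpos k) = lpos k := simpleTr_of_ne
    (by simp [lpos, Fin.ext_iff]; omega) (by simp [lpos, rpos, Fin.ext_iff]; omega)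
  have h4 : simpleTr l (rpos k) = rpos k := simpleTr_of_ne
    (by simp [lpos, rpos, Fin.ext_iff]; omega) (by simp [rpos, Fin.ext_iff]; omega)
  simp only [crossDeg, Seq.swap_vertex, h1, h2, h3, h4, and_self]

/-- In a triple crossing every two of the three strands meet once. -/
theorem crossDeg_braid {k l : Fin (len ν - 1)} (h : l.1 = k.1 + 1) (i : Seq ν) :
    crossDeg Γ k ((i.swap k).swap l) = crossDeg Γ l i ∧
      crossDeg Γ l ((i.swap l).swap k) = crossDeg Γ k i ∧
      crossDeg Γ l (i.swap k) = -cartan Γ (i.vertex (lpos k)) (i.vertex (rpos l)) ∧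
      crossDeg Γ k (i.swap l) = -cartan Γ (i.vertex (lpos k)) (i.vertex (rpos l)) := by
  have hl : lpos l = rpos k := Fin.ext h
  have hkc : rpos l ≠ lpos k := by simp [lpos, rpos, Fin.ext_iff]; omega
  have hkd : rpos l ≠ rpos k := by simp [rpos, Fin.ext_iff]; omega
  have h1 : simpleTr k (rpos l) = rpos l := simpleTr_of_ne hkc hkd
  have h2 : simpleTr l (lpos k) = lpos k := simpleTr_of_ne (hl ▸ lpos_ne_rpos k) hkc.symm
  have h3 : simpleTr l (rpos k) = rpos l := hl ▸ simpleTr_lpos l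
  have h4 : simpleTr l (rpos l) = rpos k := hl ▸ simpleTr_rpos l
  simp only [crossDeg, Seq.swap_vertex, hl, h1, h2, h3, h4, simpleTr_lpos, simpleTr_rpos, and_self]

/-- The elementary diagrams, with a formal variable recording their degrees. -/
noncomputable def degGen : Gen ν → AddMonoidAlgebra (R Γ ν) ℤ
  | .idem i => .single 0 (e Γ i)
  | .dot k i => .single 2 (x Γ k i)
  | .cross k i => .single (crossDeg Γ k i) (δ Γ k i)

/-- The coefficients satisfy the relation because it holds in `R(ν)`, so only the homogeneity of the
relation is left to check. -/
theorem lift_degGen_rel {a b : FreeAlgebra ℤ (Gen ν)} (h : Rel Γ ν a b) :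
    FreeAlgebra.lift ℤ (degGen Γ) a = FreeAlgebra.lift ℤ (degGen Γ) b := by
  have hrel := mk_rel h
  have hcongr : ∀ {d d' : ℤ} {r r' : R Γ ν}, d = d' → r = r' →
      (AddMonoidAlgebra.single d r : AddMonoidAlgebra (R Γ ν) ℤ) = .single d' r' := by
    rintro _ _ _ _ rfl rfl
    rfl
  induction h <;>
    simp only [fe, fx, fd, degGen, map_mul, map_sub, map_add, map_sum, map_one, map_zero,
      FreeAlgebra.lift_ι_apply, AddMonoidAlgebra.single_mul_single] at hrel ⊢
  case idem_mul_self => exact hcongr (add_zero _) hrel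
  case idem_mul_ne => exact (hcongr rfl hrel).trans (AddMonoidAlgebra.single_zero _)
  case sum_idem =>
    rw [AddMonoidAlgebra.one_def, ← sum_e]
    exact (map_sum (AddMonoidAlgebra.singleAddHom (0 : ℤ)) _ _).symm
  case dot_bot => exact hcongr (add_zero _) hrel
  case dot_top => exact hcongr (zero_add _) hrel
  case cross_bot => exact hcongr (add_zero _) hrel
  case cross_top => exact hcongr (zero_add _) hrel
  case dot_dot => exact hcongr rfl hrel
  case cross_dot => exact hcongr (add_comm _ _) hrel
  case cross_cross k l i h =>
    rw [(crossDeg_swap_of_lt Γ h i).1, (crossDeg_swap_of_lt Γ h i).2]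
    exact hcongr (add_comm _ _) hrel
  case double_eq => exact (hcongr rfl hrel).trans (AddMonoidAlgebra.single_zero _)
  case double_far k i hne h =>
    refine hcongr ?_ hrel
    rw [crossDeg_swap, crossDeg, cartan_of_not_adj hne h, neg_zero, add_zero]
  case double_adj k i h =>
    rw [crossDeg_swap, crossDeg, cartan_of_adj h, ← AddMonoidAlgebra.single_add]
    exact hcongr rfl hrel
  case slide_ne_left => exact hcongr (add_comm _ _) hrel
  case slide_ne_right => exact hcongr (add_comm _ _) hrel
  case slide_eq_left k i h =>
    -- A dot and a crossing of equal labels have degrees `2` and `-2`, matching the degree `0` of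
    -- `1_i`.
    rw [crossDeg, h, cartan_self, add_comm (2 : ℤ), ← AddMonoidAlgebra.single_sub]
    exact hcongr rfl hrel
  case slide_eq_right k i h =>
    rw [crossDeg, h, cartan_self, add_comm (2 : ℤ), ← AddMonoidAlgebra.single_sub]
    exact hcongr rfl hrel
  case braid_easy k l hkl i h =>
    obtain ⟨h1, h2, h3, h4⟩ := crossDeg_braid Γ hkl i
    rw [h1, h2, h3, h4]
    refine hcongr ?_ hrel
    ring
  case braid_hard k l hkl i h hadj =>
    obtain ⟨h1, h2, h3, h4⟩ := crossDeg_braid Γ hkl i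
    have hl : lpos l = rpos k := Fin.ext hkl
    -- The three crossings have degrees `1`, `-2`, `1`, with sum `0` as for `1_i`.
    have h5 : crossDeg Γ l i = 1 := by rw [crossDeg, hl, ← h, cartan_of_adj hadj.symm, neg_neg]
    have h6 : crossDeg Γ k i = 1 := by rw [crossDeg, cartan_of_adj hadj, neg_neg]
    rw [h1, h2, h3, h4, h5, h6, h, cartan_self, ← AddMonoidAlgebra.single_sub]
    exact hcongr rfl hrel

/-- The coaction describing the grading of `R(ν)`. -/
noncomputable def coaction (ν : I →₀ ℕ) : R Γ ν →+* AddMonoidAlgebra (R Γ ν) ℤ :=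
  RingQuot.lift ⟨(FreeAlgebra.lift ℤ (degGen Γ)).toRingHom, fun _ _ h => lift_degGen_rel Γ h⟩

theorem coaction_mk (a : FreeAlgebra ℤ (Gen ν)) :
    coaction Γ ν (mk Γ ν a) = FreeAlgebra.lift ℤ (degGen Γ) a :=
  RingQuot.lift_mkRingHom_apply ..

theorem coaction_eval {i j : Seq ν} (D : Diagram i j) :
    coaction Γ ν (D.eval Γ) = .single (D.degree Γ) (D.eval Γ) := by
  induction D with
  | id => simp [Diagram.eval, Diagram.degree, e, coaction_mk, fe, degGen]
  | dot k D ih =>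
    rw [Diagram.eval, map_mul, ih, x, coaction_mk, fx, FreeAlgebra.lift_ι_apply, degGen,
      AddMonoidAlgebra.single_mul_single]
    rfl
  | cross k D ih =>
    rw [Diagram.eval, map_mul, ih, δ, coaction_mk, fd, FreeAlgebra.lift_ι_apply, degGen,
      AddMonoidAlgebra.single_mul_single]
    rfl

variable {Γ}

theorem coaction_of_mem {d : ℤ} {r : R Γ ν} (hr : r ∈ degPart Γ ν d) :
    coaction Γ ν r = .single d r := by
  induction hr using Submodule.span_induction with
  | mem r hr =>
    obtain ⟨i, j, D, rfl, rfl⟩ := hr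
    exact coaction_eval Γ D
  | zero => simp
  | add r s _ _ hr hs => rw [map_add, hr, hs, AddMonoidAlgebra.single_add]
  | smul c r _ hr =>
    rw [map_zsmul, hr]
    exact (map_zsmul (AddMonoidAlgebra.singleAddHom d) c r).symm

variable (Γ) in
/-- The projection to the part of degree `d`. -/
noncomputable def degProj (ν : I →₀ ℕ) (d : ℤ) : R Γ ν →ₗ[ℤ] R Γ ν :=
  ((Finsupp.applyAddHom d).comp (AddMonoidAlgebra.coeffAddEquiv.toAddMonoidHom.comp
    (coaction Γ ν).toAddMonoidHom)).toIntLinearMap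

theorem degProj_of_mem {d : ℤ} {r : R Γ ν} (hr : r ∈ degPart Γ ν d) (d' : ℤ) :
    degProj Γ ν d' r = if d = d' then r else 0 := by
  change (coaction Γ ν r).coeff d' = _
  rw [coaction_of_mem hr]
  exact Finsupp.single_apply

/-- The projection to degree `d` is the identity on the part of degree `d` and kills all the others.
-/
theorem iSupIndep_homDegPart (j i : Seq ν) : iSupIndep (homDegPart Γ j i) := by
  intro d
  rw [Submodule.disjoint_def]
  intro r hr hr'
  have key : ⨆ d' ≠ d, homDegPart Γ j i d' ≤
      LinearMap.ker ((degProj Γ ν d).comp (homPart Γ j i).subtype) :=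
    iSup₂_le fun d' hd' r hr => (degProj_of_mem hr d).trans (if_neg hd')
  have h1 : degProj Γ ν d r = 0 := key hr'
  rw [degProj_of_mem (show (r : R Γ ν) ∈ degPart Γ ν d from hr), if_pos rfl] at h1
  exact Subtype.ext h1

theorem e_mul_eval {i j : Seq ν} (D : Diagram i j) : e Γ j * D.eval Γ = D.eval Γ := by
  cases D with
  | id => exact e_mul_self i
  | dot k D => rw [Diagram.eval, ← mul_assoc, e_mul_x]
  | cross k D => rw [Diagram.eval, ← mul_assoc, e_mul_δ]

/-- Diagrams whose top is not `j` are killed by `a = a 1_j`, so only composable ones have to be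
tested. -/
theorem mul_mem_degPart {a : R Γ ν} {d d' : ℤ} {j : Seq ν} (ha : a * e Γ j = a)
    (h : ∀ (i : Seq ν) (D : Diagram i j), D.degree Γ = d → a * D.eval Γ ∈ degPart Γ ν d')
    {r : R Γ ν} (hr : r ∈ degPart Γ ν d) : a * r ∈ degPart Γ ν d' := by
  induction hr using Submodule.span_induction with
  | mem r hr =>
    obtain ⟨i, j', D, hD, rfl⟩ := hr
    by_cases hj : j = j'
    · subst hj
      exact h i D hD
    · rw [← ha, ← e_mul_eval, mul_assoc, ← mul_assoc (e Γ j), e_mul_ne hj, zero_mul, mul_zero]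
      exact zero_mem _
  | zero => rw [mul_zero]; exact zero_mem _
  | add r s _ _ hr hs => rw [mul_add]; exact add_mem hr hs
  | smul c r _ hr => rw [mul_smul_comm]; exact Submodule.smul_mem _ c hr

theorem eval_mem_degPart {i j : Seq ν} (D : Diagram i j) :
    D.eval Γ ∈ degPart Γ ν (D.degree Γ) :=
  Submodule.subset_span ⟨i, j, D, rfl, rfl⟩

theorem e_mul_mem_degPart (j : Seq ν) {d : ℤ} {r : R Γ ν} (hr : r ∈ degPart Γ ν d) :
    e Γ j * r ∈ degPart Γ ν d :=
  mul_mem_degPart (e_mul_self j)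
    (fun _ D hD => by rw [e_mul_eval, ← hD]; exact eval_mem_degPart D) hr

theorem x_mul_mem_degPart (k : Fin (len ν)) (j : Seq ν) {d : ℤ} {r : R Γ ν}
    (hr : r ∈ degPart Γ ν d) : x Γ k j * r ∈ degPart Γ ν (2 + d) :=
  mul_mem_degPart (x_mul_e k j) (fun _ D hD => by rw [← hD]; exact eval_mem_degPart (D.dot k)) hr

theorem δ_mul_mem_degPart (k : Fin (len ν - 1)) (j : Seq ν) {d : ℤ} {r : R Γ ν}
    (hr : r ∈ degPart Γ ν d) : δ Γ k j * r ∈ degPart Γ ν (crossDeg Γ k j + d) :=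
  mul_mem_degPart (δ_mul_e k j) (fun _ D hD => by rw [← hD]; exact eval_mem_degPart (D.cross k)) hr

theorem hat_mul_mem_degPart (l : List (Fin (len ν - 1))) (i : Seq ν) {d : ℤ} {r : R Γ ν}
    (hr : r ∈ degPart Γ ν d) :
    hat Γ l i * r ∈ degPart Γ ν ((wordDiagram i l).degree Γ + d) := by
  induction l with
  | nil =>
    change e Γ i * r ∈ degPart Γ ν (0 + d)
    rw [zero_add]
    exact e_mul_mem_degPart i hr
  | cons k l ih =>
    rw [hat_cons, mul_assoc]
    have := δ_mul_mem_degPart k (i.act l) ih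
    rwa [← add_assoc] at this

theorem x_pow_mul_mem_degPart (k : Fin (len ν)) (j : Seq ν) (n : ℕ) {d : ℤ} {r : R Γ ν}
    (hr : r ∈ degPart Γ ν d) : x Γ k j ^ n * r ∈ degPart Γ ν (2 * n + d) := by
  induction n with
  | zero => simpa using hr
  | succ n ih =>
    rw [pow_succ', mul_assoc]
    have := x_mul_mem_degPart k j ih
    rwa [show (2 : ℤ) + (2 * n + d) = 2 * (n + 1 : ℕ) + d by push_cast; ring] at this

theorem dotMonomial_mul_mem_degPart (i : Seq ν) (u : Fin (len ν) → ℕ) {d : ℤ} {r : R Γ ν}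
    (hr : r ∈ degPart Γ ν d) : dotMonomial Γ i u * r ∈ degPart Γ ν (2 * ∑ k, (u k : ℤ) + d) := by
  have key : ∀ L : List (Fin (len ν)), (L.map fun k => x Γ k i ^ u k).prod * r ∈
      degPart Γ ν (2 * (L.map fun k => (u k : ℤ)).sum + d) := by
    intro L
    induction L with
    | nil => simpa using hr
    | cons k L ih =>
      rw [List.map_cons, List.map_cons, List.prod_cons, List.sum_cons, mul_assoc, mul_add, add_assoc]
      exact x_pow_mul_mem_degPart k i (u k) ih
  have := key (List.finRange (len ν))
  rwa [← List.ofFn_eq_map, ← List.ofFn_eq_map, List.sum_ofFn] at this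

theorem dotMonomial_mul_e (i : Seq ν) (u : Fin (len ν) → ℕ) :
    dotMonomial Γ i u * e Γ i = e Γ i * dotMonomial Γ i u := by
  have := dotEval_monomial Γ i (Finsupp.equivFunOnFinite.symm u)
  rw [show ⇑(Finsupp.equivFunOnFinite.symm u) = u from rfl] at this
  rw [← this, e_commute_dotEval]

theorem hat_mul_dotMonomial_mem_degPart (l : List (Fin (len ν - 1))) (i : Seq ν)
    (u : Fin (len ν) → ℕ) : hat Γ l i * dotMonomial Γ i u ∈
      degPart Γ ν ((wordDiagram i l).degree Γ + 2 * ∑ k, (u k : ℤ)) := by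
  -- The monomial with zero exponents is the unit of the ring, not a diagram, so `1_i` is borrowed
  -- from `ŵ_i` and moved to the bottom.
  rw [← hat_mul_e, mul_assoc, ← dotMonomial_mul_e]
  have := dotMonomial_mul_mem_degPart i u (eval_mem_degPart (Γ := Γ) (Diagram.id (i := i)))
  simpa [Diagram.degree, Diagram.eval] using hat_mul_mem_degPart l i this

end Grading

end KL

namespace KL

universe u

variable {I : Type u} (Γ : SimpleGraph I) {ν : I →₀ ℕ}
  (word : Equiv.Perm (Fin (len ν)) → List (Fin (len ν - 1)))

/-! ### The basis, the direct sum decomposition and faithfulness -/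

section Basis

/-- The map `(p_w)_w ↦ ∑ ŵ_i p_w`, where `w` runs over `_jS_i`. -/
noncomputable def hatSum (j i : Seq ν) :
    (permSet j i →₀ MvPolynomial (Fin (len ν)) ℤ) →ₗ[ℤ] R Γ ν :=
  Finsupp.lsum ℤ fun w => (LinearMap.mulLeft ℤ (hat Γ (word w) i)).comp (dotEval Γ i).toLinearMap

theorem hatSum_single (j i : Seq ν) (w : permSet j i) (p : MvPolynomial (Fin (len ν)) ℤ) :
    hatSum Γ word j i (Finsupp.single w p) = hat Γ (word w) i * dotEval Γ i p := by
  simp [hatSum]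

variable {Γ word}

theorem eq_zero_of_polAction_hatSum (hword : ∀ w, IsMinimalPresentation (word w) w)
    {o : Orientation Γ} {j i : Seq ν}
    {c : permSet j i →₀ MvPolynomial (Fin (len ν)) ℤ}
    (h : polAction o (hatSum Γ word j i c) = 0) : c = 0 := by
  -- Extend the coefficients by zero from `_jS_i` to all permutations, where independence is known.
  have h1 : hatSum Γ word j i c = ∑ w, hat Γ (word w) i *
      dotEval Γ i (c.mapDomain (Subtype.val : permSet j i → _) w) := by
    rw [← Finsupp.sum_fintype (c.mapDomain (Subtype.val : permSet j i → _))
      (fun w p => hat Γ (word w) i * dotEval Γ i p) (by simp),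
      Finsupp.sum_mapDomain_index (by simp) (by simp [mul_add])]
    rfl
  rw [h1] at h
  have h2 := eq_zero_of_polAction_eq_zero o word hword i _ h
  exact Finsupp.mapDomain_injective Subtype.val_injective
    ((DFunLike.coe_injective h2 : c.mapDomain _ = 0).trans Finsupp.mapDomain_zero.symm)

theorem hatSum_injective (hword : ∀ w, IsMinimalPresentation (word w) w)
    (j i : Seq ν) : Function.Injective (hatSum Γ word j i) := by
  obtain ⟨o⟩ := exists_orientation Γ
  refine (injective_iff_map_eq_zero _).2 fun c hc => ?_
  exact eq_zero_of_polAction_hatSum hword (o := o) (by rw [hc, map_zero])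

/-- The `ŵ_i` with `w(i) = j` are fixed by `1_j` on the left, and the others are killed by it. So
the spanning set of `R(ν) 1_i` cuts down to one of `1_j R(ν) 1_i`. -/
theorem range_hatSum (hword : ∀ w, IsMinimalPresentation (word w) w)
    (j i : Seq ν) : LinearMap.range (hatSum Γ word j i) = homPart Γ j i := by
  have hact : ∀ w, i.act (word w) = i.perm w := fun w => by rw [Seq.act_eq_perm, (hword w).1]
  apply le_antisymm
  · rintro _ ⟨c, rfl⟩
    induction c using Finsupp.induction_linear with
    | zero => rw [map_zero]; exact zero_mem _
    | add c d hc hd => rw [map_add]; exact add_mem hc hd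
    | single w p =>
      refine ⟨hat Γ (word w) i * dotEval Γ i p, ?_⟩
      have hj := e_mul_hat (Γ := Γ) (word w) i
      rw [hact, show i.perm w = j from w.2] at hj
      rw [hatSum_single, ← mul_assoc, hj, mul_assoc, ← e_commute_dotEval, ← mul_assoc,
        hat_mul_e]
  · rintro _ ⟨r, rfl⟩
    rw [mul_assoc]
    have hr := mul_e_mem_span word hword i r
    generalize r * e Γ i = t at hr
    induction hr using Submodule.span_induction with
    | mem r hr =>
      obtain ⟨w, p, rfl⟩ := hr
      rw [← mul_assoc]
      by_cases hj : j = i.act (word w)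
      · rw [hj, e_mul_hat]
        exact ⟨Finsupp.single ⟨w, (hact w).symm⟩ p, hatSum_single ..⟩
      · rw [e_mul_hat_ne hj, zero_mul]
        exact zero_mem _
    | zero => rw [mul_zero]; exact zero_mem _
    | add r s _ _ hr hs => rw [mul_add]; exact add_mem hr hs
    | smul c r _ hr => rw [mul_smul_comm]; exact Submodule.smul_mem _ c hr

/-- The basis of `_jR(ν)_i` formed by the elements `ŵ_i x^u`. -/
noncomputable def hatBasis (hword : ∀ w, IsMinimalPresentation (word w) w) (j i : Seq ν) :
    Module.Basis (permSet j i × (Fin (len ν) → ℕ)) ℤ (homPart Γ j i) :=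
  ((Finsupp.basis fun _ : permSet j i => MvPolynomial.basisMonomials (Fin (len ν)) ℤ).map
    ((LinearEquiv.ofInjective _ (hatSum_injective (Γ := Γ) hword j i)).trans
      (LinearEquiv.ofEq _ _ (range_hatSum hword j i)))).reindex
    ((Equiv.sigmaEquivProd _ _).trans
      ((Equiv.refl _).prodCongr Finsupp.equivFunOnFinite))

theorem hatBasis_apply (hword : ∀ w, IsMinimalPresentation (word w) w)
    (j i : Seq ν) (w : permSet j i) (u : Fin (len ν) → ℕ) :
    (hatBasis (Γ := Γ) hword j i (w, u) : R Γ ν) = hat Γ (word w) i * dotMonomial Γ i u := by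
  have := dotEval_monomial Γ i (Finsupp.equivFunOnFinite.symm u)
  rw [show ⇑(Finsupp.equivFunOnFinite.symm u) = u from rfl] at this
  rw [← this, ← hatSum_single Γ word j i]
  simp [hatBasis]

theorem hatBasis_mem (hword : ∀ w, IsMinimalPresentation (word w) w)
    (j i : Seq ν) (w : permSet j i) (u : Fin (len ν) → ℕ) :
    hatBasis (Γ := Γ) hword j i (w, u) ∈
      homDegPart Γ j i ((wordDiagram i (word w)).degree Γ + 2 * ∑ k, (u k : ℤ)) := by
  rw [homDegPart, Submodule.mem_comap, Submodule.subtype_apply, hatBasis_apply]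
  exact hat_mul_dotMonomial_mem_degPart _ _ _

theorem isInternal_homDegPart (hword : ∀ w, IsMinimalPresentation (word w) w)
    (j i : Seq ν) : DirectSum.IsInternal (homDegPart Γ j i) := by
  rw [DirectSum.isInternal_submodule_iff_iSupIndep_and_iSup_eq_top]
  refine ⟨iSupIndep_homDegPart j i, top_unique ?_⟩
  rw [← (hatBasis (Γ := Γ) hword j i).span_eq, Submodule.span_le]
  rintro _ ⟨⟨w, u⟩, rfl⟩
  exact Submodule.mem_iSup_of_mem _ (hatBasis_mem hword j i w u)

/-- An element acting by zero has all its pieces `1_j r 1_i` acting by zero. Each piece is a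
combination of the spanning elements, so triangularity makes it vanish, and the pieces add up to
`r`. -/
theorem polAction_injective (hword : ∀ w, IsMinimalPresentation (word w) w)
    (o : Orientation Γ) :
    Function.Injective (polAction (ν := ν) o) := by
  refine (injective_iff_map_eq_zero _).2 fun r hr => ?_
  have key : ∀ j i, e Γ j * r * e Γ i = 0 := fun j i => by
    obtain ⟨c, hc⟩ : e Γ j * r * e Γ i ∈ LinearMap.range (hatSum Γ word j i) := by
      rw [range_hatSum hword]
      exact ⟨r, rfl⟩
    have : polAction o (hatSum Γ word j i c) = 0 := by
      rw [hc, map_mul, map_mul, hr, mul_zero, zero_mul]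
    rw [← hc, eq_zero_of_polAction_hatSum hword this, map_zero]
  calc r = (∑ j, e Γ j) * r * ∑ i, e Γ i := by rw [sum_e, one_mul, mul_one]
    _ = ∑ i, ∑ j, e Γ j * r * e Γ i := by simp only [Finset.mul_sum, Finset.sum_mul]
    _ = 0 := by simp [key]

end Basis

end KL

theorem theorem2p5 {I : Type*} (Γ : SimpleGraph I) (ν : I →₀ ℕ)
    (word : Equiv.Perm (Fin (KL.len ν)) → List (Fin (KL.len ν - 1)))
    (hword : ∀ w, KL.IsMinimalPresentation (word w) w) :
    (∀ i j : KL.Seq ν,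
      DirectSum.IsInternal (KL.homDegPart Γ j i) ∧
      ∃ b : Module.Basis (KL.permSet j i × (Fin (KL.len ν) → ℕ)) ℤ (KL.homPart Γ j i),
        ∀ (w : KL.permSet j i) (u : Fin (KL.len ν) → ℕ),
          (b (w, u) : KL.R Γ ν) = KL.hat Γ (word w) i * KL.dotMonomial Γ i u ∧
          b (w, u) ∈ KL.homDegPart Γ j i
            ((KL.wordDiagram i (word w)).degree Γ + 2 * ∑ k, (u k : ℤ))) ∧
    (∀ o : KL.Orientation Γ,
      (∃! ρ : KL.R Γ ν →+* Module.End ℤ (KL.Pol ν), KL.IsPolAction o ρ) ∧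
      ∀ ρ : KL.R Γ ν →+* Module.End ℤ (KL.Pol ν), KL.IsPolAction o ρ →
        Function.Injective ρ) := by
  refine ⟨fun i j => ⟨KL.isInternal_homDegPart hword j i, KL.hatBasis hword j i, fun w u =>
    ⟨KL.hatBasis_apply hword j i w u, KL.hatBasis_mem hword j i w u⟩⟩, fun o =>
    ⟨⟨KL.polAction o, KL.isPolAction_polAction o, fun ρ hρ => hρ.eq_polAction⟩, fun ρ hρ => ?_⟩⟩
  rw [hρ.eq_polAction]
  exact KL.polAction_injective hword o
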